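/- Let $d\ge 1$, $\tau_0\ge 1$, and let an urn initially contain $\tau_0$ balls with (not necessarily distinct) labels $X_1,\dots,X_{\tau_0}\in\mathbb{Z}^d$, fixed but arbitrary. For $n\ge\tau_0$ let $\mu_n=\frac1n\sum_{k=1}^n\delta_{X_k}$ be the empirical distribution of the labels of the $n$ balls then in the urn; given $X_1,\dots,X_n$, two balls are drawn independently and with replacement from the urn, and a new ball is added whose label $X_{n+1}$ is the sum of the two drawn labels, so that the conditional law of $X_{n+1}$ is the law of $Z_n^1+Z_n^2$ with $Z_n^1,Z_n^2$ independent of law $\mu_n$. Then the limit $$\mathbf A=(A(1),\dots,A(d))=\lim_{n\to\infty}\frac{\mathbb{E}[X_{n+1}\mid\mu_n]}{2(n+1)}\in\mathbb{R}^d$$ exists almost surely; for every $i\in\{1,\dots,d\}$ such that at least one initial label has a nonzero $i$-th coordinate, $\mathbb{P}(A(i)\neq 0)>0$; and, almost surely, the conditional law of $X_n/n$ given $\mu_{n-1}$ converges weakly, as $n\to\infty$, to the law of $G\cdot\mathbf A$, where $G\sim\mathrm{Gamma}(2,1)$ (shape $2$, rate $1$) and the realized value of $\mathbf A$ is held fixed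 (i.e. $G$ is independent of the urn process). -/

import Mathlib

open MeasureTheory ProbabilityTheory Filter Topology
open scoped ENNReal

/-- The empirical distribution `(1/n) ∑_{k=1}^n δ_{X_k}` of the first `n` labels. -/
noncomputable def empirical {Ω : Type*} {d : ℕ} (X : ℕ → Ω → Fin d → ℤ) (n : ℕ) (ω : Ω) :
    Measure (Fin d → ℤ) :=
  (n : ℝ≥0∞)⁻¹ • ∑ k ∈ Finset.Icc 1 n, Measure.dirac (X k ω)

/-- The law of the sum of two independent draws from `m`. -/
noncomputable def twoDrawSum {d : ℕ} (m : Measure (Fin d → ℤ)) : Measure (Fin d → ℤ) :=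
  (m.prod m).map (fun z => z.1 + z.2)

/-- The σ-algebra generated by the labels `X_1, …, X_n`. -/
abbrev history {Ω : Type*} {d : ℕ} (X : ℕ → Ω → Fin d → ℤ) (n : ℕ) : MeasurableSpace Ω :=
  MeasurableSpace.comap (fun ω (k : Fin n) => X ((k : ℕ) + 1) ω) inferInstance

/-- The σ-algebra generated by the random measure `μ_n`. -/
noncomputable abbrev sigmaEmpirical {Ω : Type*} {d : ℕ} (X : ℕ → Ω → Fin d → ℤ) (n : ℕ) :
    MeasurableSpace Ω :=
  MeasurableSpace.comap (empirical X n) inferInstance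

/-- `X_1, X_2, …` are the labels of the balls of an addition urn on `ℤ^d` started from the balls
`x 0, …, x (τ₀ - 1)`: the first `τ₀` labels are the initial ones and, given the labels
`X_1, …, X_n` of the balls in the urn, `n ≥ τ₀`, the next label is distributed as the sum of two
independent draws (with replacement) from the urn. The value `X 0` plays no role. -/
structure IsAdditionUrn {Ω : Type*} [MeasurableSpace Ω] (P : Measure Ω) {d τ₀ : ℕ}
    (x : Fin τ₀ → Fin d → ℤ) (X : ℕ → Ω → Fin d → ℤ) : Prop where
  measurable : ∀ n, Measurable (X n)
  init : ∀ k : Fin τ₀, ∀ᵐ ω ∂P, X ((k : ℕ) + 1) ω = x k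
  step : ∀ n, τ₀ ≤ n → ∀ s : Set (Fin d → ℤ),
    P⟦X (n + 1) ⁻¹' s | history X n⟧ =ᵐ[P] fun ω => (twoDrawSum (empirical X n ω)).real s

/-- The inclusion of `ℤ^d` in `ℝ^d`. -/
def toRealVec {d : ℕ} (z : Fin d → ℤ) : Fin d → ℝ := fun i => (z i : ℝ)

/-- A regular conditional law of `X_{n+1} / (n+1)` given `μ_n`, evaluated at `μ_n(ω)`. -/
noncomputable def condLaw {Ω : Type*} [MeasurableSpace Ω] (P : Measure Ω) [IsProbabilityMeasure P]
    {d : ℕ} (X : ℕ → Ω → Fin d → ℤ) (n : ℕ) (ω : Ω) : ProbabilityMeasure (Fin d → ℝ) :=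
  ⟨condDistrib (fun ω' => ((n : ℝ) + 1)⁻¹ • toRealVec (X (n + 1) ω')) (empirical X n) P
    (empirical X n ω), inferInstance⟩

/-- The law of `G • a`, where `G` has the Gamma distribution with shape `2` and rate `1`. -/
noncomputable def gammaMultiple {d : ℕ} (a : Fin d → ℝ) : ProbabilityMeasure (Fin d → ℝ) :=
  ⟨(gammaMeasure 2 1).map (fun g => g • a), by
    have := isProbabilityMeasure_gammaMeasure (a := 2) (r := 1) two_pos one_pos
    exact Measure.isProbabilityMeasure_map (by fun_prop)⟩

/-! For an additive `ℓ` on `ℤ^d`, let `S_n` and `Q_n` be the sums of `ℓ(X_k)` and `ℓ(X_k)²` over `k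
≤ n`. Two draws have mean `2 S_n / n`, so `S_n / (n (n + 1))` is a martingale. The means of `S_n²`
and `Q_n` obey a closed recursion (`exists_integral_sq_le`), which bounds the martingale in `L²`; it
converges almost surely and in `L¹` (`exists_tendsto_labelSum`), and the coordinate functionals give
the vector `A`. If a limit vanished almost surely, so would the whole martingale and `ℓ(X_{τ₀+1})`,
although the conditional second moment of the latter is then `2 Q_{τ₀} / τ₀ > 0`.

For the law, fix a scale `s` and put `H_n = ∑_{k ≤ n} exp(i ℓ(X_k) / s)`. The exponential is
multiplicative, so `H_{n+1} - H_n` has conditional mean `(H_n / n)²`: `H` is a noisy form of `h' =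
(h / t)²`, solved by `t / (1 - i b t)` with `b = A / s`. Exponential moments and Borel–Cantelli keep
the noise of order `√s log s` for all `n ≤ s` (`eventually_abs_compensatedSum_le`). An error present
at time `n₀` is magnified at most about `(s / n₀)²` times (`norm_sub_le_of_quadratic_recursion`).
The start `n₀` must therefore be late enough for the magnified noise to be `o(s)`, yet `n₀ = o(s)`
so that a Taylor expansion determines `H_{n₀}` from `S_{n₀}` and `Q_{n₀}`; `n₀ ≈ s^{13/16}` does
both.

Hence the rescaled empirical characteristic function tends to `1 / (1 - i A)`, that of an
exponential multiple of `A`; two independent draws square it, which gives Gamma(2,1). Null sets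
depend on `ℓ`, so this is done at rational frequencies and extended by equicontinuity, after which
Lévy's theorem applies. -/

/-- The mean of `f` over the sums of two draws with replacement from the first `n` labels. -/
noncomputable def drawMean {Ω : Type*} {d : ℕ} (X : ℕ → Ω → Fin d → ℤ) (f : (Fin d → ℤ) → ℝ)
    (n : ℕ) (ω : Ω) : ℝ :=
  ((n : ℝ) ^ 2)⁻¹ * ∑ j ∈ Finset.Icc 1 n, ∑ k ∈ Finset.Icc 1 n, f (X j ω + X k ω)

/-! ### Two draws from the empirical measure, and measurability in the history. -/

section Empirical

variable {Ω : Type*} {d : ℕ} (X : ℕ → Ω → Fin d → ℤ)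

theorem isProbabilityMeasure_empirical {n : ℕ} (hn : 1 ≤ n) (ω : Ω) :
    IsProbabilityMeasure (empirical X n ω) := by
  constructor
  have : (n : ℝ≥0∞) ≠ 0 := by simp; omega
  simp [empirical, ENNReal.inv_mul_cancel this]

theorem twoDrawSum_empirical {n : ℕ} (hn : 1 ≤ n) (ω : Ω) :
    twoDrawSum (empirical X n ω) = ((n : ℝ≥0∞)⁻¹ * (n : ℝ≥0∞)⁻¹) •
      ∑ j ∈ Finset.Icc 1 n, ∑ k ∈ Finset.Icc 1 n, Measure.dirac (X j ω + X k ω) := by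
  have := isProbabilityMeasure_empirical X hn ω
  ext s hs
  have h1 : ∀ a : Fin d → ℤ, (Prod.mk a ⁻¹' ((fun z : (Fin d → ℤ) × (Fin d → ℤ) => z.1 + z.2) ⁻¹' s))
      = {b | a + b ∈ s} := fun a => rfl
  rw [twoDrawSum, Measure.map_apply (by fun_prop) hs, Measure.prod_apply (by measurability)]
  simp_rw [h1]
  conv_lhs => enter [1]; rw [empirical]
  rw [lintegral_smul_measure, lintegral_finsetSum_measure]
  simp only [lintegral_dirac, Measure.smul_apply, Measure.coe_finsetSum, Finset.sum_apply,
    smul_eq_mul, mul_assoc, empirical]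
  rw [← Finset.mul_sum]
  simp [Set.indicator]

theorem isProbabilityMeasure_twoDrawSum_empirical {n : ℕ} (hn : 1 ≤ n) (ω : Ω) :
    IsProbabilityMeasure (twoDrawSum (empirical X n ω)) := by
  have := isProbabilityMeasure_empirical X hn ω
  exact Measure.isProbabilityMeasure_map (by fun_prop)

theorem twoDrawSum_real_eq_drawMean {n : ℕ} (hn : 1 ≤ n) (ω : Ω) (s : Set (Fin d → ℤ)) :
    (twoDrawSum (empirical X n ω)).real s = drawMean X (s.indicator 1) n ω := by
  rw [Measure.real, twoDrawSum_empirical X hn, drawMean]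
  simp only [Measure.smul_apply, Measure.coe_finsetSum, Finset.sum_apply, smul_eq_mul,
    ENNReal.toReal_mul, ENNReal.toReal_inv, ENNReal.toReal_natCast]
  rw [ENNReal.toReal_sum (fun j _ => ENNReal.sum_ne_top.2 fun k _ => measure_ne_top _ _)]
  rw [pow_two, mul_inv]
  congr 1
  refine Finset.sum_congr rfl fun j _ => ?_
  rw [ENNReal.toReal_sum (fun k _ => measure_ne_top _ _)]
  refine Finset.sum_congr rfl fun k _ => ?_
  simp only [Measure.dirac_apply, Set.indicator]
  split_ifs <;> simp

theorem drawMean_finset_sum {ι : Type*} (s : Finset ι) (c : ι → ℝ) (f : ι → (Fin d → ℤ) → ℝ)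
    (n : ℕ) (ω : Ω) :
    drawMean X (fun v => ∑ i ∈ s, c i * f i v) n ω = ∑ i ∈ s, c i * drawMean X (f i) n ω := by
  simp only [drawMean]
  rw [Finset.sum_congr rfl fun j _ => Finset.sum_comm, Finset.sum_comm, Finset.mul_sum]
  refine Finset.sum_congr rfl fun i _ => ?_
  simp only [← Finset.mul_sum]
  ring

theorem drawMean_congr {f g : (Fin d → ℤ) → ℝ} {n : ℕ} {ω : Ω}
    (h : ∀ j ∈ Finset.Icc 1 n, ∀ k ∈ Finset.Icc 1 n, f (X j ω + X k ω) = g (X j ω + X k ω)) :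
    drawMean X f n ω = drawMean X g n ω := by
  simp only [drawMean]
  congr 1
  exact Finset.sum_congr rfl fun j hj => Finset.sum_congr rfl fun k hk => h j hj k hk

theorem measurable_history {n k : ℕ} (hk : k ∈ Finset.Icc 1 n) : Measurable[history X n] (X k) := by
  rw [Finset.mem_Icc] at hk
  have h : X k = (fun y : Fin n → Fin d → ℤ => y ⟨k - 1, by omega⟩) ∘
      (fun ω (k : Fin n) => X ((k : ℕ) + 1) ω) := by
    ext1 ω
    simp [Nat.sub_add_cancel hk.1]
  rw [h]
  exact (measurable_pi_apply _).comp (comap_measurable _)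

theorem measurable_drawMean_history (f : (Fin d → ℤ) → ℝ) (n : ℕ) :
    Measurable[history X n] (drawMean X f n) := by
  unfold drawMean
  refine Measurable.const_mul ?_ _
  refine Finset.measurable_fun_sum _ fun j hj => Finset.measurable_fun_sum _ fun k hk => ?_
  have h1 := measurable_history X hj
  have h2 := measurable_history X hk
  exact (measurable_of_countable f).comp (h1.add h2)

theorem history_mono {m n : ℕ} (h : m ≤ n) : history X m ≤ history X n := by
  rw [history, ← measurable_iff_comap_le]
  refine @measurable_pi_lambda _ _ _ (history X n) _ _ fun k => ?_
  exact measurable_history X (by simp; omega)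

theorem history_le [MeasurableSpace Ω] (hX : ∀ n, Measurable (X n)) (n : ℕ) :
    history X n ≤ ‹MeasurableSpace Ω› := by
  rw [history, ← measurable_iff_comap_le]
  exact measurable_pi_lambda _ fun k => hX _

theorem measurable_empirical_history (n : ℕ) : Measurable[history X n] (empirical X n) := by
  refine @Measure.measurable_of_measurable_coe _ _ _ (history X n) _ fun s hs => ?_
  simp only [empirical, Measure.smul_apply, Measure.coe_finsetSum, Finset.sum_apply, smul_eq_mul]
  refine Measurable.const_mul (Finset.measurable_fun_sum _ fun j hj => ?_) _
  simp only [Measure.dirac_apply]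
  exact (measurable_of_countable (s.indicator (1 : (Fin d → ℤ) → ℝ≥0∞))).comp
    (measurable_history X hj)

theorem sigmaEmpirical_le_history (n : ℕ) : sigmaEmpirical X n ≤ history X n :=
  measurable_iff_comap_le.1 (measurable_empirical_history X n)

end Empirical

/-! ### Finite support of the labels and conditional means given the history. -/

namespace IsAdditionUrn

variable {Ω : Type*} [MeasurableSpace Ω] {P : Measure Ω}
    {d τ₀ : ℕ} {x : Fin τ₀ → Fin d → ℤ} {X : ℕ → Ω → Fin d → ℤ}

theorem measurable_comp (hX : IsAdditionUrn P x X) (f : (Fin d → ℤ) → ℝ) (n : ℕ) :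
    Measurable fun ω => f (X n ω) :=
  (measurable_of_countable f).comp (hX.measurable n)

theorem condExp_indicator (hX : IsAdditionUrn P x X) (hτ₀ : 1 ≤ τ₀) {n : ℕ} (hn : τ₀ ≤ n)
    (s : Set (Fin d → ℤ)) :
    P[fun ω => s.indicator 1 (X (n + 1) ω) | history X n] =ᵐ[P] drawMean X (s.indicator 1) n := by
  have h := hX.step n hn s
  have e : (fun ω => s.indicator (1 : (Fin d → ℤ) → ℝ) (X (n + 1) ω)) =
      (X (n + 1) ⁻¹' s).indicator fun _ => (1 : ℝ) := by
    ext ω; by_cases h : X (n + 1) ω ∈ s <;> simp [h]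
  rw [e]
  filter_upwards [h] with ω hω
  rw [hω, twoDrawSum_real_eq_drawMean X (hτ₀.trans hn)]

variable [IsProbabilityMeasure P]

/-- The labels of the first `n` balls almost surely lie in a deterministic finite set. -/
theorem exists_finset_forall_mem (hX : IsAdditionUrn P x X) (hτ₀ : 1 ≤ τ₀) (n : ℕ) :
    ∃ V : Finset (Fin d → ℤ), ∀ᵐ ω ∂P, ∀ k ∈ Finset.Icc 1 n, X k ω ∈ V := by
  classical
  induction n with
  | zero => exact ⟨∅, by simp⟩
  | succ n ih =>
    obtain ⟨V, hV⟩ := ih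
    rcases lt_or_ge n τ₀ with hn | hn
    · refine ⟨insert (x ⟨n, hn⟩) V, ?_⟩
      filter_upwards [hV, hX.init ⟨n, hn⟩] with ω h1 h2 k hk
      rcases eq_or_ne k (n + 1) with rfl | h
      · simpa using Or.inl h2
      · exact Finset.mem_insert_of_mem (h1 k (by simp at hk ⊢; omega))
    -- A new label is a sum of two old ones: the conditional probability of leaving `V + V` is a
    -- mean over pairs of an indicator that vanishes on all of them.
    · set W : Finset (Fin d → ℤ) := (V ×ˢ V).image fun z => z.1 + z.2 with hW
      have h0 : ∀ᵐ ω ∂P, X (n + 1) ω ∈ W := by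
        have h1 := hX.condExp_indicator hτ₀ hn (s := (W : Set (Fin d → ℤ))ᶜ)
        have h2 : drawMean X ((W : Set (Fin d → ℤ))ᶜ.indicator 1) n =ᵐ[P] 0 := by
          filter_upwards [hV] with ω hω
          rw [drawMean_congr X (g := fun _ => 0)]
          · simp [drawMean]
          · intro j hj k hk
            rw [Set.indicator_of_notMem]
            simp only [Set.mem_compl_iff, not_not, Finset.mem_coe, hW, Finset.mem_image]
            exact ⟨(X j ω, X k ω), by simp [hω j hj, hω k hk], rfl⟩
        have h3 := integral_condExp (μ := P) (f := fun ω =>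
          (W : Set (Fin d → ℤ))ᶜ.indicator (1 : (Fin d → ℤ) → ℝ) (X (n + 1) ω))
          (history_le X hX.measurable n)
        rw [integral_congr_ae (h1.trans h2)] at h3
        simp only [Pi.zero_apply, integral_zero] at h3
        rw [eq_comm, integral_eq_zero_iff_of_nonneg] at h3
        · filter_upwards [h3] with ω hω
          by_contra hc
          rw [Set.indicator_of_mem (by simpa using hc)] at hω
          simp at hω
        · intro ω
          exact Set.indicator_nonneg (by simp) _
        · refine Integrable.of_bound (hX.measurable_comp _ _).aestronglyMeasurable 1 (ae_of_all _ fun ω => ?_)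
          simp only [Set.indicator]
          split_ifs <;> simp
      refine ⟨V ∪ W, ?_⟩
      filter_upwards [hV, h0] with ω h1 h2 k hk
      rcases eq_or_ne k (n + 1) with rfl | h
      · exact Finset.mem_union_right _ h2
      · exact Finset.mem_union_left _ (h1 k (by simp at hk ⊢; omega))

theorem exists_finset_mem (hX : IsAdditionUrn P x X) (hτ₀ : 1 ≤ τ₀) {n : ℕ} (hn : 1 ≤ n) :
    ∃ V : Finset (Fin d → ℤ), ∀ᵐ ω ∂P, X n ω ∈ V := by
  obtain ⟨V, hV⟩ := hX.exists_finset_forall_mem hτ₀ n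
  exact ⟨V, hV.mono fun ω h => h n (by simp [hn])⟩

/-- A function of the first `n` labels is almost surely bounded. -/
theorem exists_bound (hX : IsAdditionUrn P x X) (hτ₀ : 1 ≤ τ₀) (f : (Fin d → ℤ) → ℝ) (n : ℕ) :
    ∃ B : ℝ, 0 ≤ B ∧ ∀ᵐ ω ∂P, ∀ k ∈ Finset.Icc 1 n, |f (X k ω)| ≤ B := by
  obtain ⟨V, hV⟩ := hX.exists_finset_forall_mem hτ₀ n
  refine ⟨∑ v ∈ V, |f v|, Finset.sum_nonneg fun _ _ => abs_nonneg _, hV.mono fun ω h k hk => ?_⟩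
  exact Finset.single_le_sum (f := fun v => |f v|) (fun _ _ => abs_nonneg _) (h k hk)

theorem integrable_comp (hX : IsAdditionUrn P x X) (hτ₀ : 1 ≤ τ₀) (f : (Fin d → ℤ) → ℝ) {n : ℕ}
    (hn : 1 ≤ n) : Integrable (fun ω => f (X n ω)) P := by
  obtain ⟨B, -, hB⟩ := hX.exists_bound hτ₀ f n
  exact Integrable.of_bound (hX.measurable_comp _ _).aestronglyMeasurable B
    (hB.mono fun ω h => h n (by simp [hn]))

/-- The urn dynamics only prescribe probabilities of events. As the labels almost surely take
finitely many values, `f` is there a finite combination of indicators of points, and linearity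
suffices. -/
theorem condExp_comp_history (hX : IsAdditionUrn P x X) (hτ₀ : 1 ≤ τ₀) {n : ℕ} (hn : τ₀ ≤ n)
    (f : (Fin d → ℤ) → ℝ) :
    P[fun ω => f (X (n + 1) ω) | history X n] =ᵐ[P] drawMean X f n := by
  classical
  obtain ⟨V, hV⟩ := hX.exists_finset_forall_mem hτ₀ n
  obtain ⟨W, hW⟩ := hX.exists_finset_mem hτ₀ (n := n + 1) (by omega)
  -- `U` covers both the values of the new label and the sums of pairs of old labels, so that one
  -- expansion of `f` serves on both sides.
  set U : Finset (Fin d → ℤ) := W ∪ (V ×ˢ V).image fun z => z.1 + z.2 with hU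
  have key : ∀ v ∈ U, f v = ∑ u ∈ U, f u * ({u} : Set (Fin d → ℤ)).indicator 1 v := by
    intro v hv
    rw [Finset.sum_eq_single v]
    · simp
    · intro u _ hne
      rw [Set.indicator_of_notMem (by simpa using hne.symm), mul_zero]
    · exact fun h => (h hv).elim
  have h1 : (fun ω => f (X (n + 1) ω)) =ᵐ[P]
      ∑ u ∈ U, f u • fun ω => ({u} : Set (Fin d → ℤ)).indicator (1 : (Fin d → ℤ) → ℝ) (X (n + 1) ω) := by
    filter_upwards [hW] with ω hω
    rw [key _ (Finset.mem_union_left _ hω)]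
    simp [Finset.sum_apply]
  have h2 : ∀ᵐ ω ∂P, drawMean X f n ω =
      ∑ u ∈ U, f u * drawMean X (({u} : Set (Fin d → ℤ)).indicator 1) n ω := by
    filter_upwards [hV] with ω hω
    rw [← drawMean_finset_sum]
    refine drawMean_congr X fun j hj k hk => key _ (Finset.mem_union_right _ ?_)
    exact Finset.mem_image.2 ⟨(X j ω, X k ω), by simp [hω j hj, hω k hk], rfl⟩
  have h3 : ∀ᵐ ω ∂P, ∀ u ∈ U, P[f u • fun ω => ({u} : Set (Fin d → ℤ)).indicator (1 : (Fin d → ℤ) → ℝ)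
      (X (n + 1) ω) | history X n] ω = f u * drawMean X (({u} : Set (Fin d → ℤ)).indicator 1) n ω := by
    refine (Filter.eventually_all_finset U).2 fun u _ => ?_
    filter_upwards [condExp_smul (μ := P) (f u) (fun ω => ({u} : Set (Fin d → ℤ)).indicator
      (1 : (Fin d → ℤ) → ℝ) (X (n + 1) ω)) (history X n), hX.condExp_indicator hτ₀ hn {u}] with ω h4 h5
    rw [h4, Pi.smul_apply, h5, smul_eq_mul]
  have h6 := condExp_finsetSum (μ := P) (s := U) (f := fun u => f u • fun ω =>
    ({u} : Set (Fin d → ℤ)).indicator (1 : (Fin d → ℤ) → ℝ) (X (n + 1) ω))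
    (fun u _ => (hX.integrable_comp hτ₀ _ (by omega)).smul (f u)) (history X n)
  filter_upwards [condExp_congr_ae (m := history X n) h1, h6, h2, h3] with ω g1 g2 g3 g4
  rw [g1, g2, g3, Finset.sum_apply]
  exact Finset.sum_congr rfl fun u hu => g4 u hu

end IsAdditionUrn

/-! ### Conditioning on the empirical measure alone. -/

theorem empirical_real_singleton {Ω : Type*} {d : ℕ} (X : ℕ → Ω → Fin d → ℤ) (n : ℕ) (ω : Ω)
    (a : Fin d → ℤ) : (empirical X n ω).real {a} =
      (n : ℝ)⁻¹ * ∑ j ∈ Finset.Icc 1 n, ({X j ω} : Set (Fin d → ℤ)).indicator 1 a := by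
  rw [Measure.real, empirical]
  simp only [Measure.smul_apply, Measure.coe_finsetSum, Finset.sum_apply, smul_eq_mul,
    ENNReal.toReal_mul, ENNReal.toReal_inv, ENNReal.toReal_natCast]
  rw [ENNReal.toReal_sum (fun k _ => measure_ne_top _ _)]
  congr 1
  refine Finset.sum_congr rfl fun k _ => ?_
  rw [Measure.dirac_apply]
  by_cases h : X k ω = a
  · simp [h]
  · rw [Set.indicator_of_notMem (by simpa using h),
      Set.indicator_of_notMem (by simpa using Ne.symm h)]
    simp

/-- The mean over pairs depends on the labels only through `μ_n`; by the tower property,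
conditioning on `μ_n` then gives the same result as conditioning on the whole history. -/
theorem drawMean_eq_sum_empirical {Ω : Type*} {d : ℕ} (X : ℕ → Ω → Fin d → ℤ)
    (f : (Fin d → ℤ) → ℝ) (n : ℕ) (ω : Ω) (V : Finset (Fin d → ℤ))
    (hV : ∀ k ∈ Finset.Icc 1 n, X k ω ∈ V) :
    drawMean X f n ω = ∑ a ∈ V, ∑ b ∈ V,
      f (a + b) * ((empirical X n ω).real {a} * (empirical X n ω).real {b}) := by
  have pick : ∀ (g : (Fin d → ℤ) → ℝ), ∑ j ∈ Finset.Icc 1 n, g (X j ω) =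
      ∑ a ∈ V, g a * ∑ j ∈ Finset.Icc 1 n, ({X j ω} : Set (Fin d → ℤ)).indicator 1 a := by
    intro g
    simp_rw [Finset.mul_sum]
    rw [Finset.sum_comm]
    refine Finset.sum_congr rfl fun j hj => ?_
    rw [Finset.sum_eq_single (X j ω)]
    · simp
    · intro u _ hne
      rw [Set.indicator_of_notMem (by simpa using hne), mul_zero]
    · exact fun h => (h (hV j hj)).elim
  simp_rw [empirical_real_singleton, drawMean]
  rw [pick fun a => ∑ k ∈ Finset.Icc 1 n, f (a + X k ω), Finset.mul_sum]
  refine Finset.sum_congr rfl fun a _ => ?_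
  rw [pick fun b => f (a + b), Finset.sum_mul, Finset.mul_sum]
  refine Finset.sum_congr rfl fun b _ => ?_
  rw [pow_two, mul_inv]
  ring

namespace IsAdditionUrn

variable {Ω : Type*} [MeasurableSpace Ω] {P : Measure Ω} [IsProbabilityMeasure P]
    {d τ₀ : ℕ} {x : Fin τ₀ → Fin d → ℤ} {X : ℕ → Ω → Fin d → ℤ}

theorem condExp_comp_sigmaEmpirical (hX : IsAdditionUrn P x X) (hτ₀ : 1 ≤ τ₀) {n : ℕ}
    (hn : τ₀ ≤ n) (f : (Fin d → ℤ) → ℝ) :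
    P[fun ω => f (X (n + 1) ω) | sigmaEmpirical X n] =ᵐ[P] drawMean X f n := by
  obtain ⟨V, hV⟩ := hX.exists_finset_forall_mem hτ₀ n
  have hle := history_le X hX.measurable n
  have h1 := condExp_condExp_of_le (μ := P) (f := fun ω => f (X (n + 1) ω))
    (sigmaEmpirical_le_history X n) hle
  have h2 := condExp_congr_ae (m := sigmaEmpirical X n) (hX.condExp_comp_history hτ₀ hn f)
  have h3 : AEStronglyMeasurable[sigmaEmpirical X n] (drawMean X f n) P := by
    refine ⟨fun ω => ∑ a ∈ V, ∑ b ∈ V,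
      f (a + b) * ((empirical X n ω).real {a} * (empirical X n ω).real {b}), ?_, ?_⟩
    · have hm : Measurable fun m : Measure (Fin d → ℤ) =>
          ∑ a ∈ V, ∑ b ∈ V, f (a + b) * (m.real {a} * m.real {b}) := by
        refine Finset.measurable_fun_sum _ fun a _ => Finset.measurable_fun_sum _ fun b _ => ?_
        exact ((Measure.measurable_coe (measurableSet_singleton a)).ennreal_toReal.mul
          (Measure.measurable_coe (measurableSet_singleton b)).ennreal_toReal).const_mul _
      exact (hm.comp (comap_measurable (empirical X n))).stronglyMeasurable
    · filter_upwards [hV] with ω hω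
      exact drawMean_eq_sum_empirical X f n ω V hω
  have h4 : Integrable (drawMean X f n) P :=
    integrable_condExp.congr (hX.condExp_comp_history hτ₀ hn f)
  have h5 := condExp_of_aestronglyMeasurable' ((sigmaEmpirical_le_history X n).trans hle) h3 h4
  exact (h1.symm.trans h2).trans h5

theorem integrable_toRealVec (hX : IsAdditionUrn P x X) (hτ₀ : 1 ≤ τ₀) {n : ℕ} (hn : 1 ≤ n) :
    Integrable (fun ω => toRealVec (X n ω)) P :=
  Integrable.of_eval fun i => hX.integrable_comp hτ₀ (fun v => (v i : ℝ)) hn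

theorem condExp_toRealVec (hX : IsAdditionUrn P x X) (hτ₀ : 1 ≤ τ₀) {n : ℕ} (hn : τ₀ ≤ n) :
    ∀ᵐ ω ∂P, ∀ i, P[fun ω' => toRealVec (X (n + 1) ω') | sigmaEmpirical X n] ω i =
      drawMean X (fun v => (v i : ℝ)) n ω := by
  refine ae_all_iff.2 fun i => ?_
  have h1 := ContinuousLinearMap.comp_condExp_comm (m := sigmaEmpirical X n)
    (hX.integrable_toRealVec hτ₀ (n := n + 1) (by omega))
    (ContinuousLinearMap.proj (R := ℝ) (φ := fun _ : Fin d => ℝ) i)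
  filter_upwards [h1, hX.condExp_comp_sigmaEmpirical hτ₀ hn fun v => (v i : ℝ)] with ω h2 h3
  rw [← h3]
  exact h2

/-- Labels live in a countable space, so agreement on each singleton, with one null set per point,
identifies the conditional distribution; rescaling is a pushforward. -/
theorem condLaw_eq (hX : IsAdditionUrn P x X) (hτ₀ : 1 ≤ τ₀) {n : ℕ} (hn : τ₀ ≤ n) :
    ∀ᵐ ω ∂P, (condLaw P X n ω : Measure (Fin d → ℝ)) =
      (twoDrawSum (empirical X n ω)).map fun v => ((n : ℝ) + 1)⁻¹ • toRealVec v := by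
  have hm : Measurable (empirical X n) :=
    (measurable_empirical_history X n).mono (history_le X hX.measurable n) le_rfl
  set F : (Fin d → ℤ) → (Fin d → ℝ) := fun v => ((n : ℝ) + 1)⁻¹ • toRealVec v with hF
  have hFm : Measurable F := measurable_of_countable F
  have h1 := ae_of_ae_map hm.aemeasurable
    (condDistrib_comp (μ := P) (empirical X n) (hX.measurable (n + 1)).aemeasurable hFm)
  have h2 : ∀ᵐ ω ∂P, ∀ v : Fin d → ℤ,
      (condDistrib (X (n + 1)) (empirical X n) P (empirical X n ω)).real {v} =
        (twoDrawSum (empirical X n ω)).real {v} := by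
    refine ae_all_iff.2 fun v => ?_
    have h3 := condDistrib_ae_eq_condExp (μ := P) hm (hX.measurable (n + 1))
      (measurableSet_singleton v)
    have h4 := hX.condExp_comp_sigmaEmpirical hτ₀ hn (({v} : Set (Fin d → ℤ)).indicator 1)
    have e : (fun ω => ({v} : Set (Fin d → ℤ)).indicator (1 : (Fin d → ℤ) → ℝ) (X (n + 1) ω)) =
        (X (n + 1) ⁻¹' {v}).indicator fun _ => (1 : ℝ) := by
      ext ω; by_cases h : X (n + 1) ω = v <;> simp [h]
    rw [e] at h4
    filter_upwards [h3, h4] with ω h5 h6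
    rw [h5, twoDrawSum_real_eq_drawMean X (hτ₀.trans hn)]
    exact h6
  filter_upwards [h1, h2] with ω h5 h6
  have h7 : condDistrib (X (n + 1)) (empirical X n) P (empirical X n ω) =
      twoDrawSum (empirical X n ω) := by
    have := isProbabilityMeasure_twoDrawSum_empirical X (hτ₀.trans hn) ω
    refine Measure.ext_of_singleton fun v => ?_
    exact (measureReal_eq_measureReal_iff).1 (h6 v)
  rw [← h7, ← Kernel.map_apply _ hFm, ← h5]
  rfl

end IsAdditionUrn

/-! ### Moment recursions for additive functionals. -/

/-- The sum of `f` over the first `n` labels. -/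
noncomputable def labelSum {Ω : Type*} {d : ℕ} (X : ℕ → Ω → Fin d → ℤ) (f : (Fin d → ℤ) → ℝ)
    (n : ℕ) (ω : Ω) : ℝ :=
  ∑ k ∈ Finset.Icc 1 n, f (X k ω)

section Algebra

variable {Ω : Type*} {d : ℕ} (X : ℕ → Ω → Fin d → ℤ)

theorem labelSum_succ (f : (Fin d → ℤ) → ℝ) (n : ℕ) (ω : Ω) :
    labelSum X f (n + 1) ω = labelSum X f n ω + f (X (n + 1) ω) := by
  rw [labelSum, labelSum, Finset.sum_Icc_succ_top (by omega)]

theorem labelSum_nonneg {f : (Fin d → ℤ) → ℝ} (hf : ∀ v, 0 ≤ f v) (n : ℕ) (ω : Ω) :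
    0 ≤ labelSum X f n ω :=
  Finset.sum_nonneg fun _ _ => hf _

theorem abs_drawMean_le {f : (Fin d → ℤ) → ℝ} {B : ℝ} (hB : 0 ≤ B) (hf : ∀ v, |f v| ≤ B) (n : ℕ)
    (ω : Ω) : |drawMean X f n ω| ≤ B := by
  rcases Nat.eq_zero_or_pos n with rfl | hn
  · simpa [drawMean] using hB
  have hn' : (0 : ℝ) < n := by exact_mod_cast hn
  rw [drawMean, abs_mul, abs_of_nonneg (by positivity), inv_mul_le_iff₀ (by positivity)]
  calc |∑ j ∈ Finset.Icc 1 n, ∑ k ∈ Finset.Icc 1 n, f (X j ω + X k ω)|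
      ≤ ∑ j ∈ Finset.Icc 1 n, ∑ k ∈ Finset.Icc 1 n, |f (X j ω + X k ω)| :=
        (Finset.abs_sum_le_sum_abs _ _).trans
          (Finset.sum_le_sum fun j _ => Finset.abs_sum_le_sum_abs _ _)
    _ ≤ ∑ j ∈ Finset.Icc 1 n, ∑ k ∈ Finset.Icc 1 n, B :=
        Finset.sum_le_sum fun j _ => Finset.sum_le_sum fun k _ => hf _
    _ = (n : ℝ) ^ 2 * B := by simp; ring

theorem measurable_labelSum_history (f : (Fin d → ℤ) → ℝ) (n : ℕ) :
    Measurable[history X n] (labelSum X f n) := by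
  unfold labelSum
  exact Finset.measurable_fun_sum _ fun j hj =>
    (measurable_of_countable f).comp (measurable_history X hj)

theorem drawMean_additive {n : ℕ} (hn : 1 ≤ n) (f : (Fin d → ℤ) → ℝ) (ω : Ω) :
    ((n : ℝ) ^ 2)⁻¹ * ∑ j ∈ Finset.Icc 1 n, ∑ k ∈ Finset.Icc 1 n, (f (X j ω) + f (X k ω)) =
      2 / n * labelSum X f n ω := by
  have hn' : (n : ℝ) ≠ 0 := by positivity
  simp only [Finset.sum_add_distrib, Finset.sum_const, Nat.card_Icc, labelSum, nsmul_eq_mul,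
    ← Finset.mul_sum]
  push_cast [Nat.add_sub_cancel]
  field_simp
  ring

theorem drawMean_addMonoidHom {n : ℕ} (hn : 1 ≤ n) (ℓ : (Fin d → ℤ) →+ ℝ) (ω : Ω) :
    drawMean X ℓ n ω = 2 / n * labelSum X ℓ n ω := by
  rw [← drawMean_additive X hn, drawMean]
  simp only [map_add]

theorem drawMean_abs_le {n : ℕ} (hn : 1 ≤ n) (ℓ : (Fin d → ℤ) →+ ℝ) (ω : Ω) :
    drawMean X (fun v => |ℓ v|) n ω ≤ 2 / n * labelSum X (fun v => |ℓ v|) n ω := by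
  rw [← drawMean_additive X hn, drawMean]
  refine mul_le_mul_of_nonneg_left (Finset.sum_le_sum fun j _ => Finset.sum_le_sum fun k _ => ?_)
    (by positivity)
  rw [map_add]
  exact abs_add_le _ _

/-- In `(a + b)² = a² + b² + 2ab` the cross term factorises over the two draws; this couples `Q_n`
to `S_n²` and closes the system of second moments. -/
theorem drawMean_sq {n : ℕ} (hn : 1 ≤ n) (ℓ : (Fin d → ℤ) →+ ℝ) (ω : Ω) :
    drawMean X (fun v => ℓ v ^ 2) n ω =
      2 / n * labelSum X (fun v => ℓ v ^ 2) n ω + 2 / n ^ 2 * labelSum X ℓ n ω ^ 2 := by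
  rw [← drawMean_additive X hn, drawMean]
  have h : labelSum X ℓ n ω ^ 2 =
      ∑ j ∈ Finset.Icc 1 n, ∑ k ∈ Finset.Icc 1 n, ℓ (X j ω) * ℓ (X k ω) := by
    rw [pow_two, labelSum, Finset.sum_mul_sum]
  rw [h, div_eq_mul_inv, mul_comm 2, mul_assoc, ← mul_add]
  congr 1
  rw [Finset.mul_sum, ← Finset.sum_add_distrib]
  refine Finset.sum_congr rfl fun j _ => ?_
  rw [Finset.mul_sum, ← Finset.sum_add_distrib]
  refine Finset.sum_congr rfl fun k _ => ?_
  rw [map_add]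
  ring

end Algebra

namespace IsAdditionUrn

variable {Ω : Type*} [MeasurableSpace Ω] {P : Measure Ω}
    {d τ₀ : ℕ} {x : Fin τ₀ → Fin d → ℤ} {X : ℕ → Ω → Fin d → ℤ}

theorem measurable_labelSum (hX : IsAdditionUrn P x X) (f : (Fin d → ℤ) → ℝ) (n : ℕ) :
    Measurable (labelSum X f n) :=
  (measurable_labelSum_history X f n).mono (history_le X hX.measurable n) le_rfl

variable [IsProbabilityMeasure P]

theorem exists_bound_labelSum (hX : IsAdditionUrn P x X) (hτ₀ : 1 ≤ τ₀) (f : (Fin d → ℤ) → ℝ)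
    (n : ℕ) : ∃ B : ℝ, ∀ᵐ ω ∂P, ‖labelSum X f n ω‖ ≤ B := by
  obtain ⟨B, -, hB⟩ := hX.exists_bound hτ₀ f n
  refine ⟨∑ k ∈ Finset.Icc 1 n, B, hB.mono fun ω h => ?_⟩
  rw [labelSum]
  exact norm_sum_le_of_le _ h

theorem integrable_labelSum (hX : IsAdditionUrn P x X) (hτ₀ : 1 ≤ τ₀) (f : (Fin d → ℤ) → ℝ)
    (n : ℕ) : Integrable (labelSum X f n) P := by
  obtain ⟨B, hB⟩ := hX.exists_bound_labelSum hτ₀ f n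
  exact Integrable.of_bound (hX.measurable_labelSum f n).aestronglyMeasurable B hB

theorem integrable_labelSum_sq (hX : IsAdditionUrn P x X) (hτ₀ : 1 ≤ τ₀) (f : (Fin d → ℤ) → ℝ)
    (n : ℕ) : Integrable (fun ω => labelSum X f n ω ^ 2) P := by
  obtain ⟨B, hB⟩ := hX.exists_bound_labelSum hτ₀ f n
  refine Integrable.of_bound ((hX.measurable_labelSum f n).pow_const 2).aestronglyMeasurable (B ^ 2)
    (hB.mono fun ω h => ?_)
  rw [norm_pow]
  gcongr

theorem integral_mul_comp (hX : IsAdditionUrn P x X) (hτ₀ : 1 ≤ τ₀) {n : ℕ} (hn : τ₀ ≤ n)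
    (f : (Fin d → ℤ) → ℝ) {G : Ω → ℝ} (hG : Measurable[history X n] G)
    (hb : ∃ B : ℝ, ∀ᵐ ω ∂P, ‖G ω‖ ≤ B) :
    ∫ ω, G ω * f (X (n + 1) ω) ∂P = ∫ ω, G ω * drawMean X f n ω ∂P := by
  obtain ⟨B, hB⟩ := hb
  have hle := history_le X hX.measurable n
  have hint := hX.integrable_comp hτ₀ f (n := n + 1) (by omega)
  have h1 := condExp_mul_of_stronglyMeasurable_left (μ := P) (m := history X n) (f := G)
    (g := fun ω => f (X (n + 1) ω)) hG.stronglyMeasurable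
    (hint.bdd_mul (hG.mono hle le_rfl).aestronglyMeasurable hB) hint
  have h2 := integral_condExp (μ := P) (f := G * fun ω => f (X (n + 1) ω)) hle
  rw [show (∫ ω, G ω * f (X (n + 1) ω) ∂P) = ∫ ω, (G * fun ω => f (X (n + 1) ω)) ω ∂P from rfl,
    ← h2]
  refine integral_congr_ae ?_
  filter_upwards [h1, hX.condExp_comp_history hτ₀ hn f] with ω h3 h4
  rw [h3, Pi.mul_apply, h4]

theorem integral_comp (hX : IsAdditionUrn P x X) (hτ₀ : 1 ≤ τ₀) {n : ℕ} (hn : τ₀ ≤ n)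
    (f : (Fin d → ℤ) → ℝ) : ∫ ω, f (X (n + 1) ω) ∂P = ∫ ω, drawMean X f n ω ∂P := by
  have := hX.integral_mul_comp hτ₀ hn f (G := fun _ => 1) measurable_const ⟨1, by simp⟩
  simpa using this

theorem integral_labelSum_sq_succ (hX : IsAdditionUrn P x X) (hτ₀ : 1 ≤ τ₀) {n : ℕ} (hn : τ₀ ≤ n)
    (ℓ : (Fin d → ℤ) →+ ℝ) :
    ∫ ω, labelSum X (fun v => ℓ v ^ 2) (n + 1) ω ∂P =
      (1 + 2 / n) * ∫ ω, labelSum X (fun v => ℓ v ^ 2) n ω ∂P +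
        2 / n ^ 2 * ∫ ω, labelSum X ℓ n ω ^ 2 ∂P := by
  simp_rw [labelSum_succ]
  rw [integral_add (hX.integrable_labelSum hτ₀ _ n) (hX.integrable_comp hτ₀ (fun v => ℓ v ^ 2) (by omega)),
    hX.integral_comp hτ₀ hn (fun v => ℓ v ^ 2)]
  simp_rw [drawMean_sq X (hτ₀.trans hn)]
  rw [integral_add ((hX.integrable_labelSum hτ₀ _ n).const_mul _)
    ((hX.integrable_labelSum_sq hτ₀ _ n).const_mul _), integral_const_mul, integral_const_mul]
  ring

theorem integral_sq_labelSum_succ (hX : IsAdditionUrn P x X) (hτ₀ : 1 ≤ τ₀) {n : ℕ} (hn : τ₀ ≤ n)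
    (ℓ : (Fin d → ℤ) →+ ℝ) :
    ∫ ω, labelSum X ℓ (n + 1) ω ^ 2 ∂P =
      (1 + 4 / n + 2 / n ^ 2) * ∫ ω, labelSum X ℓ n ω ^ 2 ∂P +
        2 / n * ∫ ω, labelSum X (fun v => ℓ v ^ 2) n ω ∂P := by
  have hle := history_le X hX.measurable n
  obtain ⟨B, hB⟩ := hX.exists_bound_labelSum hτ₀ ℓ n
  have e : ∀ ω, labelSum X ℓ (n + 1) ω ^ 2 = labelSum X ℓ n ω ^ 2 +
      (2 * (labelSum X ℓ n ω * ℓ (X (n + 1) ω)) + ℓ (X (n + 1) ω) ^ 2) := by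
    intro ω; rw [labelSum_succ]; ring
  simp_rw [e]
  have i1 := hX.integrable_labelSum_sq hτ₀ ℓ n
  have i2 : Integrable (fun ω => labelSum X ℓ n ω * ℓ (X (n + 1) ω)) P :=
    (hX.integrable_comp hτ₀ ℓ (by omega)).bdd_mul
      (hX.measurable_labelSum ℓ n).aestronglyMeasurable hB
  have i3 := hX.integrable_comp hτ₀ (fun v => ℓ v ^ 2) (n := n + 1) (by omega)
  have i4 := hX.integrable_labelSum hτ₀ (fun v => ℓ v ^ 2) n
  have i5 : Integrable (fun ω => 2 * (labelSum X ℓ n ω * ℓ (X (n + 1) ω)) + ℓ (X (n + 1) ω) ^ 2) P :=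
    (i2.const_mul 2).add i3
  rw [integral_add i1 i5, integral_add (i2.const_mul 2) i3,
    integral_const_mul, hX.integral_mul_comp hτ₀ hn ℓ (measurable_labelSum_history X ℓ n) ⟨B, hB⟩,
    hX.integral_comp hτ₀ hn (fun v => ℓ v ^ 2)]
  simp_rw [drawMean_sq X (hτ₀.trans hn), drawMean_addMonoidHom X (hτ₀.trans hn)]
  have e2 : ∀ ω, labelSum X ℓ n ω * (2 / n * labelSum X ℓ n ω) = 2 / n * labelSum X ℓ n ω ^ 2 := by
    intro ω; ring
  simp_rw [e2]
  rw [integral_add (i4.const_mul _) (i1.const_mul _), integral_const_mul, integral_const_mul,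
    integral_const_mul]
  ring

/-- Adding the two recursions gives a growth factor at most `1 + 4/n + 4/n² = ((n + 2)/n)²`, whose
product telescopes to a multiple of `(n (n + 1))²`. -/
theorem exists_integral_sq_le (hX : IsAdditionUrn P x X) (hτ₀ : 1 ≤ τ₀) (ℓ : (Fin d → ℤ) →+ ℝ) :
    ∃ C : ℝ, 0 ≤ C ∧ ∀ n, τ₀ ≤ n →
      (∫ ω, labelSum X ℓ n ω ^ 2 ∂P) + ∫ ω, labelSum X (fun v => ℓ v ^ 2) n ω ∂P ≤
        C * ((n : ℝ) * (n + 1)) ^ 2 := by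
  have hs : ∀ n, 0 ≤ ∫ ω, labelSum X ℓ n ω ^ 2 ∂P := fun n =>
    integral_nonneg fun ω => sq_nonneg _
  have hq : ∀ n, 0 ≤ ∫ ω, labelSum X (fun v => ℓ v ^ 2) n ω ∂P := fun n =>
    integral_nonneg fun ω => labelSum_nonneg X (fun v => sq_nonneg _) n ω
  refine ⟨(∫ ω, labelSum X ℓ τ₀ ω ^ 2 ∂P) + ∫ ω, labelSum X (fun v => ℓ v ^ 2) τ₀ ω ∂P,
    add_nonneg (hs _) (hq _), fun n hn => ?_⟩
  induction n, hn using Nat.le_induction with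
  | base =>
    refine le_mul_of_one_le_right (add_nonneg (hs _) (hq _)) (one_le_pow₀ ?_)
    have : (1 : ℝ) ≤ τ₀ := by exact_mod_cast hτ₀
    nlinarith
  | succ n hn ih =>
    have hn' : (1 : ℝ) ≤ n := by exact_mod_cast hτ₀.trans hn
    rw [hX.integral_sq_labelSum_succ hτ₀ hn, hX.integral_labelSum_sq_succ hτ₀ hn]
    set C := (∫ ω, labelSum X ℓ τ₀ ω ^ 2 ∂P) + ∫ ω, labelSum X (fun v => ℓ v ^ 2) τ₀ ω ∂P
    set s := ∫ ω, labelSum X ℓ n ω ^ 2 ∂P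
    set q := ∫ ω, labelSum X (fun v => ℓ v ^ 2) n ω ∂P
    have h0 : 0 ≤ 4 / (n : ℝ) ^ 2 * q := mul_nonneg (by positivity) (hq n)
    have h1 : (1 + 4 / (n : ℝ) + 2 / n ^ 2) * s + 2 / n * q + ((1 + 2 / n) * q + 2 / n ^ 2 * s) ≤
        (1 + 4 / (n : ℝ) + 4 / n ^ 2) * (s + q) := by
      refine (le_add_of_nonneg_right h0).trans (le_of_eq ?_)
      ring
    refine h1.trans ?_
    refine (mul_le_mul_of_nonneg_left ih (by positivity)).trans (le_of_eq ?_)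
    push_cast
    field_simp
    ring

/-- The mean of `Q_n` alone grows by `1 + 2/n` with a forcing `2/n²` times the mean of `S_n²`, which
is only of order `n²`. This improves the previous fourth-order bound on it by one power. -/
theorem exists_integral_labelSum_sq_le (hX : IsAdditionUrn P x X) (hτ₀ : 1 ≤ τ₀)
    (ℓ : (Fin d → ℤ) →+ ℝ) :
    ∃ C : ℝ, 0 ≤ C ∧ ∀ n, τ₀ ≤ n →
      ∫ ω, labelSum X (fun v => ℓ v ^ 2) n ω ∂P ≤ C * (n : ℝ) ^ 3 := by
  obtain ⟨C, hC, h⟩ := hX.exists_integral_sq_le hτ₀ ℓ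
  have hq : ∀ n, 0 ≤ ∫ ω, labelSum X (fun v => ℓ v ^ 2) n ω ∂P := fun n =>
    integral_nonneg fun ω => labelSum_nonneg X (fun v => sq_nonneg _) n ω
  -- `D ≥ 2C` lets the increment of `D n² (n + 1)` absorb the forcing `2C (n + 1)²`; the other
  -- summand handles the base case.
  set D := 2 * C + ∫ ω, labelSum X (fun v => ℓ v ^ 2) τ₀ ω ∂P with hD
  have hD0 : 0 ≤ D := add_nonneg (by positivity) (hq _)
  have key : ∀ n, τ₀ ≤ n → ∫ ω, labelSum X (fun v => ℓ v ^ 2) n ω ∂P ≤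
      D * ((n : ℝ) ^ 2 * (n + 1)) := by
    intro n hn
    induction n, hn using Nat.le_induction with
    | base =>
      have : (1 : ℝ) ≤ τ₀ := by exact_mod_cast hτ₀
      have h1 : (1 : ℝ) ≤ (τ₀ : ℝ) ^ 2 * (τ₀ + 1) := by nlinarith [one_le_pow₀ this (n := 2)]
      exact (by linarith : _ ≤ D).trans (le_mul_of_one_le_right hD0 h1)
    | succ n hn ih =>
      have hn' : (1 : ℝ) ≤ n := by exact_mod_cast hτ₀.trans hn
      rw [hX.integral_labelSum_sq_succ hτ₀ hn]
      have hs := (le_add_of_nonneg_right (hq n)).trans (h n hn)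
      have h1 := mul_le_mul_of_nonneg_left ih (by positivity : 0 ≤ 1 + 2 / (n : ℝ))
      have h2 := mul_le_mul_of_nonneg_left hs (by positivity : 0 ≤ 2 / (n : ℝ) ^ 2)
      refine (add_le_add h1 h2).trans ?_
      have e : (1 + 2 / (n : ℝ)) * (D * (n ^ 2 * (n + 1))) + 2 / n ^ 2 * (C * (n * (n + 1)) ^ 2) =
          D * n * (n + 1) * (n + 2) + 2 * C * (n + 1) ^ 2 := by
        field_simp
      rw [e]
      push_cast
      have hCD : 2 * C ≤ D := by linarith [hq τ₀]
      nlinarith [mul_le_mul_of_nonneg_right hCD (by positivity : 0 ≤ ((n : ℝ) + 1) ^ 2),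
        mul_nonneg hD0 (by positivity : 0 ≤ ((n : ℝ) + 1) ^ 1)]
  refine ⟨2 * D, by positivity, fun n hn => (key n hn).trans ?_⟩
  have hn' : (1 : ℝ) ≤ n := by exact_mod_cast hτ₀.trans hn
  rw [mul_comm 2, mul_assoc]
  refine mul_le_mul_of_nonneg_left ?_ hD0
  nlinarith [mul_le_mul_of_nonneg_left hn' (by positivity : 0 ≤ (n : ℝ) ^ 2)]

end IsAdditionUrn

/-! ### Martingale convergence of the normalized sums. -/

/-- A sequence of functions bounded in `L²` of a probability measure is uniformly integrable. -/
theorem uniformIntegrable_of_integral_sq_le {Ω : Type*} [MeasurableSpace Ω] {P : Measure Ω}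
    [IsProbabilityMeasure P] {f : ℕ → Ω → ℝ} (hf : ∀ n, Measurable (f n))
    (hint : ∀ n, Integrable (fun ω => f n ω ^ 2) P) {C : ℝ} (hC : ∀ n, ∫ ω, f n ω ^ 2 ∂P ≤ C) :
    UniformIntegrable f 1 P := by
  refine uniformIntegrable_of le_rfl ENNReal.one_ne_top (fun n => (hf n).aestronglyMeasurable)
    fun ε hε => ?_
  have hC0 : 0 ≤ C := (integral_nonneg fun ω => sq_nonneg _).trans (hC 0)
  -- Where `|f| ≥ K`, one has `|f| ≤ f² / K`, of integral at most `C / K ≤ ε`; the `+ 1` keeps `K`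
  -- positive.
  set K : NNReal := (C / ε).toNNReal + 1 with hK
  have hK0 : (0 : ℝ) < K := by positivity
  have hK1 : C / K ≤ ε := by
    rw [div_le_iff₀ hK0, ← div_le_iff₀' hε, hK]
    push_cast
    rw [Real.coe_toNNReal _ (by positivity)]
    linarith
  refine ⟨K, fun n => ?_⟩
  rw [eLpNorm_one_eq_lintegral_enorm]
  calc ∫⁻ ω, ‖{ω | K ≤ ‖f n ω‖₊}.indicator (f n) ω‖ₑ ∂P
      ≤ ∫⁻ ω, ENNReal.ofReal (f n ω ^ 2 / K) ∂P := by
        refine lintegral_mono fun ω => ?_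
        by_cases h : K ≤ ‖f n ω‖₊
        · rw [Set.indicator_of_mem (by exact h), ← ofReal_norm]
          refine ENNReal.ofReal_le_ofReal ?_
          have h' : (K : ℝ) ≤ ‖f n ω‖ := by exact_mod_cast h
          rw [le_div_iff₀ hK0, ← sq_abs, pow_two, Real.norm_eq_abs] at *
          exact mul_le_mul_of_nonneg_left h' (abs_nonneg _)
        · rw [Set.indicator_of_notMem (by exact h)]
          simp
    _ = ENNReal.ofReal (∫ ω, f n ω ^ 2 / K ∂P) :=
        (ofReal_integral_eq_lintegral_ofReal ((hint n).div_const _)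
          (ae_of_all _ fun ω => by positivity)).symm
    _ ≤ ENNReal.ofReal ε := by
        refine ENNReal.ofReal_le_ofReal ?_
        rw [integral_div]
        exact (div_le_div_of_nonneg_right (hC n) hK0.le).trans hK1

namespace IsAdditionUrn

variable {Ω : Type*} [MeasurableSpace Ω] {P : Measure Ω}
    {d τ₀ : ℕ} {x : Fin τ₀ → Fin d → ℤ} {X : ℕ → Ω → Fin d → ℤ}

/-- The filtration of the labels, started when the urn holds its `τ₀` initial balls. -/
def filtration (hX : IsAdditionUrn P x X) : Filtration ℕ ‹MeasurableSpace Ω› where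
  seq k := history X (τ₀ + k)
  mono' _ _ h := history_mono X (Nat.add_le_add_left h τ₀)
  le' _ := history_le X hX.measurable _

/-- `∑_{k ≤ n} f(X_k)`, normalized by `n (n + 1)`, along the filtration of the urn. -/
noncomputable def normalizedSum (X : ℕ → Ω → Fin d → ℤ) (τ₀ : ℕ) (f : (Fin d → ℤ) → ℝ) (k : ℕ)
    (ω : Ω) : ℝ :=
  (((τ₀ + k : ℕ) : ℝ) * ((τ₀ + k : ℕ) + 1))⁻¹ * labelSum X f (τ₀ + k) ω

theorem stronglyAdapted_normalizedSum (hX : IsAdditionUrn P x X) (f : (Fin d → ℤ) → ℝ) :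
    StronglyAdapted hX.filtration (normalizedSum X τ₀ f) := fun k =>
  ((measurable_labelSum_history X f (τ₀ + k)).const_mul _).stronglyMeasurable

variable [IsProbabilityMeasure P]

theorem integrable_normalizedSum (hX : IsAdditionUrn P x X) (hτ₀ : 1 ≤ τ₀)
    (f : (Fin d → ℤ) → ℝ) (k : ℕ) : Integrable (normalizedSum X τ₀ f k) P :=
  (hX.integrable_labelSum hτ₀ f _).const_mul _

theorem condExp_normalizedSum_succ (hX : IsAdditionUrn P x X) (hτ₀ : 1 ≤ τ₀)
    (f : (Fin d → ℤ) → ℝ) (k : ℕ) :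
    P[normalizedSum X τ₀ f (k + 1) | hX.filtration k] =ᵐ[P] fun ω =>
      (((τ₀ + k : ℕ) + 1) * ((τ₀ + k : ℕ) + 2 : ℝ))⁻¹ *
        (labelSum X f (τ₀ + k) ω + drawMean X f (τ₀ + k) ω) := by
  have e : normalizedSum X τ₀ f (k + 1) = (((τ₀ + k : ℕ) + 1) * ((τ₀ + k : ℕ) + 2 : ℝ))⁻¹ •
      (labelSum X f (τ₀ + k) + fun ω => f (X (τ₀ + k + 1) ω)) := by
    ext ω
    rw [normalizedSum, ← add_assoc, labelSum_succ, Pi.smul_apply, Pi.add_apply, smul_eq_mul]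
    push_cast
    ring_nf
  rw [e]
  have i1 := hX.integrable_labelSum hτ₀ f (τ₀ + k)
  have i2 := hX.integrable_comp hτ₀ f (n := τ₀ + k + 1) (by omega)
  have hle := history_le X hX.measurable (τ₀ + k)
  have h1 := condExp_of_stronglyMeasurable (μ := P) hle
    (measurable_labelSum_history X f (τ₀ + k)).stronglyMeasurable i1
  filter_upwards [condExp_smul (μ := P) (((τ₀ + k : ℕ) + 1) * ((τ₀ + k : ℕ) + 2 : ℝ))⁻¹
    (labelSum X f (τ₀ + k) + fun ω => f (X (τ₀ + k + 1) ω)) (history X (τ₀ + k)),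
    condExp_add i1 i2 (history X (τ₀ + k)),
    hX.condExp_comp_history hτ₀ (Nat.le_add_right τ₀ k) f] with ω h2 h3 h4
  change (P[_ | history X (τ₀ + k)]) ω = _
  rw [h2, Pi.smul_apply, h3, Pi.add_apply, h4, h1, smul_eq_mul]

/-- The conditional growth factor `1 + 2/n` of `S_n` is the ratio of `(n + 1)(n + 2)` to `n (n +
1)`. -/
theorem martingale_normalizedSum (hX : IsAdditionUrn P x X) (hτ₀ : 1 ≤ τ₀)
    (ℓ : (Fin d → ℤ) →+ ℝ) : Martingale (normalizedSum X τ₀ ℓ) hX.filtration P := by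
  refine martingale_nat (hX.stronglyAdapted_normalizedSum ℓ) (hX.integrable_normalizedSum hτ₀ ℓ)
    fun k => ?_
  filter_upwards [hX.condExp_normalizedSum_succ hτ₀ ℓ k] with ω h
  rw [h, drawMean_addMonoidHom X (by omega), normalizedSum]
  have : ((τ₀ + k : ℕ) : ℝ) ≠ 0 := by norm_cast; omega
  field_simp

theorem supermartingale_normalizedSum_abs (hX : IsAdditionUrn P x X) (hτ₀ : 1 ≤ τ₀)
    (ℓ : (Fin d → ℤ) →+ ℝ) :
    Supermartingale (normalizedSum X τ₀ fun v => |ℓ v|) hX.filtration P := by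
  refine supermartingale_nat (hX.stronglyAdapted_normalizedSum _)
    (hX.integrable_normalizedSum hτ₀ _) fun k => ?_
  filter_upwards [hX.condExp_normalizedSum_succ hτ₀ (fun v => |ℓ v|) k] with ω h
  rw [h]
  have h1 := drawMean_abs_le X (n := τ₀ + k) (by omega) ℓ ω
  refine (mul_le_mul_of_nonneg_left (add_le_add_right h1 _) (by positivity)).trans (le_of_eq ?_)
  rw [normalizedSum]
  have : ((τ₀ + k : ℕ) : ℝ) ≠ 0 := by norm_cast; omega
  field_simp

/-- A nonnegative supermartingale converges, hence is bounded along almost every path. The bound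
later makes the characteristic functions equicontinuous. -/
theorem exists_forall_labelSum_abs_le (hX : IsAdditionUrn P x X) (hτ₀ : 1 ≤ τ₀)
    (ℓ : (Fin d → ℤ) →+ ℝ) :
    ∀ᵐ ω ∂P, ∃ B : ℝ, ∀ n, τ₀ ≤ n → labelSum X (fun v => |ℓ v|) n ω ≤ B * (n : ℝ) ^ 2 := by
  have hs := hX.supermartingale_normalizedSum_abs hτ₀ ℓ
  have hnn : ∀ k ω, 0 ≤ normalizedSum X τ₀ (fun v => |ℓ v|) k ω := fun k ω =>
    mul_nonneg (by positivity) (labelSum_nonneg X (fun v => abs_nonneg _) _ _)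
  have hbdd : ∀ k, eLpNorm ((-normalizedSum X τ₀ fun v => |ℓ v|) k) 1 P ≤
      (∫ ω, normalizedSum X τ₀ (fun v => |ℓ v|) 0 ω ∂P).toNNReal := by
    intro k
    rw [Pi.neg_apply, eLpNorm_neg, eLpNorm_one_eq_lintegral_enorm,
      ← ofReal_integral_norm_eq_lintegral_enorm (hX.integrable_normalizedSum hτ₀ _ k)]
    refine ENNReal.ofReal_le_ofReal ?_
    simp_rw [Real.norm_of_nonneg (hnn k _)]
    have := hs.setIntegral_le (Nat.zero_le k) MeasurableSet.univ
    simpa using this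
  filter_upwards [hs.neg.ae_tendsto_limitProcess hbdd] with ω hω
  obtain ⟨B, hB⟩ := hω.neg.bddAbove_range
  refine ⟨2 * |B|, fun n hn => ?_⟩
  have h1 := hB (Set.mem_range_self (n - τ₀))
  simp only [Pi.neg_apply, neg_neg, normalizedSum, Nat.add_sub_cancel' hn] at h1
  have hn' : (1 : ℝ) ≤ n := by exact_mod_cast hτ₀.trans hn
  rw [inv_mul_le_iff₀ (by positivity)] at h1
  refine h1.trans ((mul_le_mul_of_nonneg_left (le_abs_self B) (by positivity)).trans ?_)
  rw [mul_comm, mul_comm 2, mul_assoc]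
  exact mul_le_mul_of_nonneg_left (by nlinarith) (abs_nonneg B)

/-- The almost sure limit of `S_n / (n (n + 1))` for an additive functional of the labels; it does
not vanish identically unless the functional vanishes on the initial labels. -/
theorem exists_tendsto_labelSum (hX : IsAdditionUrn P x X) (hτ₀ : 1 ≤ τ₀)
    (ℓ : (Fin d → ℤ) →+ ℝ) :
    ∃ A : Ω → ℝ, Measurable A ∧
      (∀ᵐ ω ∂P, Tendsto (fun n : ℕ => ((n : ℝ) * (n + 1))⁻¹ * labelSum X ℓ n ω) atTop (𝓝 (A ω))) ∧
      ((∃ k, ℓ (x k) ≠ 0) → 0 < P {ω | A ω ≠ 0}) := by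
  have hm := hX.martingale_normalizedSum hτ₀ ℓ
  obtain ⟨C, hC0, hC⟩ := hX.exists_integral_sq_le hτ₀ ℓ
  have hsq : ∀ k ω, normalizedSum X τ₀ ℓ k ω ^ 2 =
      ((((τ₀ + k : ℕ) : ℝ) * ((τ₀ + k : ℕ) + 1)) ^ 2)⁻¹ * labelSum X ℓ (τ₀ + k) ω ^ 2 := by
    intro k ω
    rw [normalizedSum, mul_pow, inv_pow]
  have hmeas : ∀ k, Measurable (normalizedSum X τ₀ ℓ k) := fun k =>
    (hX.measurable_labelSum ℓ _).const_mul _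
  have hui : UniformIntegrable (normalizedSum X τ₀ ℓ) 1 P := by
    refine uniformIntegrable_of_integral_sq_le hmeas (fun k => ?_) (C := C) fun k => ?_
    · simp_rw [hsq]
      exact (hX.integrable_labelSum_sq hτ₀ ℓ _).const_mul _
    · simp_rw [hsq]
      have hpos : (0 : ℝ) < ((τ₀ + k : ℕ) : ℝ) := by norm_cast; omega
      rw [integral_const_mul, inv_mul_le_iff₀ (by positivity), mul_comm]
      refine le_trans (le_add_of_nonneg_right ?_) (hC (τ₀ + k) (Nat.le_add_right _ _))
      exact integral_nonneg fun ω => labelSum_nonneg X (fun v => sq_nonneg _) _ _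
  set A := hX.filtration.limitProcess (normalizedSum X τ₀ ℓ) P with hA
  have hlim := hm.submartingale.ae_tendsto_limitProcess_of_uniformIntegrable hui
  refine ⟨A, (Filtration.stronglyMeasurable_limit_process').measurable, ?_, ?_⟩
  · filter_upwards [hlim] with ω hω
    rw [← tendsto_add_atTop_iff_nat τ₀]
    refine hω.congr fun k => ?_
    rw [normalizedSum, add_comm k τ₀]
  · rintro ⟨k, hk⟩
    rw [pos_iff_ne_zero]
    intro h0
    have hA0 : A =ᵐ[P] 0 := by
      rw [EventuallyEq, ae_iff]
      exact h0
    -- Uniform integrability recovers every term of the martingale as a conditional expectation of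
    -- its limit.
    have hM : ∀ j, normalizedSum X τ₀ ℓ j =ᵐ[P] 0 := fun j =>
      (hm.ae_eq_condExp_limitProcess hui j).trans
        ((condExp_congr_ae hA0).trans (by rw [condExp_zero]))
    have hS : ∀ j, ∀ᵐ ω ∂P, labelSum X ℓ (τ₀ + j) ω = 0 := by
      intro j
      filter_upwards [hM j] with ω hω
      have hpos : (0 : ℝ) < ((τ₀ + j : ℕ) : ℝ) := by norm_cast; omega
      exact (mul_eq_zero.1 hω).resolve_left (inv_ne_zero (by positivity))
    have hY : (fun ω => ℓ (X (τ₀ + 1) ω) ^ 2) =ᵐ[P] fun _ => (0 : ℝ) := by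
      filter_upwards [hS 0, hS 1] with ω h1 h2
      rw [labelSum_succ, show labelSum X ℓ τ₀ ω = 0 from h1, zero_add] at h2
      simp [h2]
    have h3 := hX.condExp_comp_history hτ₀ le_rfl fun v => ℓ v ^ 2
    have h4 : P[fun ω => ℓ (X (τ₀ + 1) ω) ^ 2 | history X τ₀] =ᵐ[P] 0 :=
      (condExp_congr_ae hY).trans (by rw [show (fun _ : Ω => (0 : ℝ)) = 0 from rfl, condExp_zero])
    -- With `S_{τ₀} = 0` the conditional second moment reduces to `2 Q_{τ₀} / τ₀`, and `Q_{τ₀}`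
    -- contains the nonzero square `ℓ (x k) ^ 2`.
    have hfalse : ∀ᵐ ω ∂P, False := by
      filter_upwards [h3, h4, hS 0, hX.init k] with ω g1 g2 g3 g4
      rw [g1, drawMean_sq X hτ₀, show labelSum X ℓ τ₀ ω = 0 from g3] at g2
      have hτ : (0 : ℝ) < τ₀ := by exact_mod_cast hτ₀
      have g5 : ℓ (X ((k : ℕ) + 1) ω) ^ 2 ≤ labelSum X (fun v => ℓ v ^ 2) τ₀ ω :=
        Finset.single_le_sum (f := fun j => ℓ (X j ω) ^ 2) (fun _ _ => sq_nonneg _)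
          (by simp)
      rw [g4] at g5
      have g6 : 0 < ℓ (x k) ^ 2 := by positivity
      have g7 : 0 < 2 / (τ₀ : ℝ) * labelSum X (fun v => ℓ v ^ 2) τ₀ ω :=
        mul_pos (by positivity) (g6.trans_le g5)
      simp at g2
      rcases g2 with h | h
      · omega
      · linarith
    simp at hfalse
    exact IsProbabilityMeasure.ne_zero P hfalse

end IsAdditionUrn

/-! ### Concentration of the compensated sums. -/

/-- The compensated sums of `g` over the labels added to the urn. -/
noncomputable def compensatedSum {Ω : Type*} {d : ℕ} (X : ℕ → Ω → Fin d → ℤ) (τ₀ : ℕ)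
    (g : (Fin d → ℤ) → ℝ) (n : ℕ) (ω : Ω) : ℝ :=
  ∑ k ∈ Finset.Ico τ₀ n, (g (X (k + 1) ω) - drawMean X g k ω)

section Algebra

variable {Ω : Type*} {d : ℕ} (X : ℕ → Ω → Fin d → ℤ)

theorem compensatedSum_succ {τ₀ n : ℕ} (hn : τ₀ ≤ n) (g : (Fin d → ℤ) → ℝ) (ω : Ω) :
    compensatedSum X τ₀ g (n + 1) ω =
      compensatedSum X τ₀ g n ω + (g (X (n + 1) ω) - drawMean X g n ω) := by
  rw [compensatedSum, compensatedSum, Finset.sum_Ico_succ_top hn]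

theorem measurable_compensatedSum_history (τ₀ : ℕ) (g : (Fin d → ℤ) → ℝ) (n : ℕ) :
    Measurable[history X n] (compensatedSum X τ₀ g n) := by
  unfold compensatedSum
  refine Finset.measurable_fun_sum _ fun k hk => ?_
  rw [Finset.mem_Ico] at hk
  have h1 : Measurable[history X n] fun ω => g (X (k + 1) ω) :=
    (measurable_of_countable g).comp (measurable_history X (by simp; omega))
  exact h1.sub ((measurable_drawMean_history X g k).mono (history_mono X hk.2.le) le_rfl)

theorem abs_sub_drawMean_le {g : (Fin d → ℤ) → ℝ} (hg : ∀ v, |g v| ≤ 1) (n : ℕ) (ω : Ω) :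
    |g (X (n + 1) ω) - drawMean X g n ω| ≤ 2 := by
  have h1 := hg (X (n + 1) ω)
  have h2 := abs_drawMean_le X zero_le_one hg n ω
  rw [abs_le] at *
  constructor <;> linarith

theorem abs_compensatedSum_le (τ₀ : ℕ) {g : (Fin d → ℤ) → ℝ} (hg : ∀ v, |g v| ≤ 1) (n : ℕ)
    (ω : Ω) : |compensatedSum X τ₀ g n ω| ≤ 2 * n := by
  refine (Finset.abs_sum_le_sum_abs _ _).trans
    ((Finset.sum_le_sum fun k _ => abs_sub_drawMean_le X hg k ω).trans ?_)
  rw [Finset.sum_const, Nat.card_Ico, nsmul_eq_mul, mul_comm]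
  gcongr
  omega

theorem compensatedSum_neg (τ₀ : ℕ) (g : (Fin d → ℤ) → ℝ) (n : ℕ) (ω : Ω) :
    compensatedSum X τ₀ (fun v => -g v) n ω = -compensatedSum X τ₀ g n ω := by
  simp only [compensatedSum, drawMean, ← Finset.sum_neg_distrib]
  refine Finset.sum_congr rfl fun k _ => ?_
  simp only [Finset.sum_neg_distrib]
  ring

end Algebra

namespace IsAdditionUrn

variable {Ω : Type*} [MeasurableSpace Ω] {P : Measure Ω}
    {d τ₀ : ℕ} {x : Fin τ₀ → Fin d → ℤ} {X : ℕ → Ω → Fin d → ℤ}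

theorem measurable_compensatedSum (hX : IsAdditionUrn P x X) (g : (Fin d → ℤ) → ℝ) (n : ℕ) :
    Measurable (compensatedSum X τ₀ g n) :=
  (measurable_compensatedSum_history X τ₀ g n).mono (history_le X hX.measurable n) le_rfl

variable [IsProbabilityMeasure P]

theorem integrable_exp_compensatedSum (hX : IsAdditionUrn P x X) {g : (Fin d → ℤ) → ℝ}
    (hg : ∀ v, |g v| ≤ 1) (t : ℝ) (n : ℕ) :
    Integrable (fun ω => Real.exp (t * compensatedSum X τ₀ g n ω)) P := by
  refine Integrable.of_bound ((hX.measurable_compensatedSum g n).const_mul t).exp.aestronglyMeasurable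
    (Real.exp (|t| * (2 * n))) (ae_of_all _ fun ω => ?_)
  rw [Real.norm_eq_abs, Real.abs_exp, Real.exp_le_exp]
  refine (le_abs_self _).trans ?_
  rw [abs_mul]
  exact mul_le_mul_of_nonneg_left (abs_compensatedSum_le X τ₀ hg n ω) (abs_nonneg t)

/-- Increments are centred given the past and bounded by `2`. As `|t| ≤ 1/2`, the bound `e^z ≤ 1 + z
+ z²` for `|z| ≤ 1` applies, and each step costs a factor at most `1 + 4t² ≤ e^{4t²}`. -/
theorem integral_exp_compensatedSum_le (hX : IsAdditionUrn P x X) (hτ₀ : 1 ≤ τ₀)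
    {g : (Fin d → ℤ) → ℝ} (hg : ∀ v, |g v| ≤ 1) {t : ℝ} (ht : |t| ≤ 1 / 2) {n : ℕ} (hn : τ₀ ≤ n) :
    ∫ ω, Real.exp (t * compensatedSum X τ₀ g n ω) ∂P ≤ Real.exp (4 * t ^ 2 * n) := by
  induction n, hn using Nat.le_induction with
  | base =>
    simp only [compensatedSum, Finset.Ico_self, Finset.sum_empty, mul_zero, Real.exp_zero]
    simp only [integral_const, probReal_univ, smul_eq_mul, mul_one]
    exact Real.one_le_exp (by positivity)
  | succ n hn ih =>
    set G : Ω → ℝ := fun ω => Real.exp (t * compensatedSum X τ₀ g n ω) with hG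
    have hGi : Integrable G P := hX.integrable_exp_compensatedSum hg t n
    have hGm : Measurable[history X n] G :=
      ((measurable_compensatedSum_history X τ₀ g n).const_mul t).exp
    have hGm' : Measurable G := hGm.mono (history_le X hX.measurable n) le_rfl
    have hGb : ∃ B : ℝ, ∀ᵐ ω ∂P, ‖G ω‖ ≤ B := by
      refine ⟨Real.exp (|t| * (2 * n)), ae_of_all _ fun ω => ?_⟩
      rw [Real.norm_eq_abs, Real.abs_exp, Real.exp_le_exp]
      refine (le_abs_self _).trans ?_
      rw [abs_mul]
      exact mul_le_mul_of_nonneg_left (abs_compensatedSum_le X τ₀ hg n ω) (abs_nonneg t)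
    have i1 : Integrable (fun ω => G ω * g (X (n + 1) ω)) P :=
      hGi.mul_bdd (c := 1) (hX.measurable_comp g _).aestronglyMeasurable
        (ae_of_all _ fun ω => hg _)
    have i2 : Integrable (fun ω => G ω * drawMean X g n ω) P :=
      hGi.mul_bdd (c := 1) ((measurable_drawMean_history X g n).mono
        (history_le X hX.measurable n) le_rfl).aestronglyMeasurable
        (ae_of_all _ fun ω => abs_drawMean_le X zero_le_one hg n ω)
    have hpt : ∀ ω, Real.exp (t * compensatedSum X τ₀ g (n + 1) ω) ≤
        (1 + 4 * t ^ 2) * G ω + t * (G ω * g (X (n + 1) ω) - G ω * drawMean X g n ω) := by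
      intro ω
      set y := g (X (n + 1) ω) - drawMean X g n ω with hy
      have hy2 : |y| ≤ 2 := abs_sub_drawMean_le X hg n ω
      have h1 : |t * y| ≤ 1 := by
        rw [abs_mul]
        nlinarith [abs_nonneg t, abs_nonneg y]
      have h2 := (abs_le.1 (Real.abs_exp_sub_one_sub_id_le h1)).2
      have h3 : (t * y) ^ 2 ≤ 4 * t ^ 2 := by
        rw [mul_pow]
        have : y ^ 2 ≤ 4 := by rw [← sq_abs]; nlinarith [abs_nonneg y]
        nlinarith [sq_nonneg t]
      have hGpos : 0 < G ω := Real.exp_pos _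
      rw [compensatedSum_succ X hn, mul_add, Real.exp_add, ← mul_sub, ← hy]
      change G ω * Real.exp (t * y) ≤ _
      nlinarith
    have i3 : Integrable (fun ω => t * (G ω * g (X (n + 1) ω) - G ω * drawMean X g n ω)) P :=
      (i1.sub i2).const_mul t
    calc ∫ ω, Real.exp (t * compensatedSum X τ₀ g (n + 1) ω) ∂P
        ≤ ∫ ω, ((1 + 4 * t ^ 2) * G ω +
            t * (G ω * g (X (n + 1) ω) - G ω * drawMean X g n ω)) ∂P :=
          integral_mono (hX.integrable_exp_compensatedSum hg t (n + 1))
            ((hGi.const_mul _).add i3) hpt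
      _ = (1 + 4 * t ^ 2) * ∫ ω, G ω ∂P := by
          rw [integral_add (hGi.const_mul _) i3, integral_const_mul, integral_const_mul,
            integral_sub i1 i2, hX.integral_mul_comp hτ₀ hn g hGm hGb]
          ring
      _ ≤ Real.exp (4 * t ^ 2) * Real.exp (4 * t ^ 2 * n) := by
          refine mul_le_mul ?_ ih (integral_nonneg fun ω => (Real.exp_pos _).le) (Real.exp_pos _).le
          linarith [Real.add_one_le_exp (4 * t ^ 2)]
      _ = Real.exp (4 * t ^ 2 * (n + 1 : ℕ)) := by
          rw [← Real.exp_add]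
          push_cast
          ring_nf

/-- Chernoff's bound at `t = 1 / (2√σ)`, chosen so that `4t²n ≤ 1` for every `n ≤ σ`. -/
theorem measureReal_le_compensatedSum (hX : IsAdditionUrn P x X) (hτ₀ : 1 ≤ τ₀)
    {g : (Fin d → ℤ) → ℝ} (hg : ∀ v, |g v| ≤ 1) {n σ : ℕ} (hn : τ₀ ≤ n) (hσ : n ≤ σ) (r : ℝ) :
    P.real {ω | r ≤ compensatedSum X τ₀ g n ω} ≤ Real.exp (1 - r / (2 * √σ)) := by
  have hσ1 : (1 : ℝ) ≤ σ := by exact_mod_cast (hτ₀.trans hn).trans hσ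
  have hs1 : 1 ≤ √(σ : ℝ) := Real.one_le_sqrt.2 hσ1
  have ht0 : 0 ≤ 1 / (2 * √(σ : ℝ)) := by positivity
  have ht : |1 / (2 * √(σ : ℝ))| ≤ 1 / 2 := by
    rw [abs_of_nonneg ht0]
    exact one_div_le_one_div_of_le (by norm_num) (by linarith)
  have h1 := measure_ge_le_exp_mul_mgf r ht0
    (hX.integrable_exp_compensatedSum (τ₀ := τ₀) hg (1 / (2 * √(σ : ℝ))) n)
  refine h1.trans ?_
  refine (mul_le_mul_of_nonneg_left (hX.integral_exp_compensatedSum_le hτ₀ hg ht hn)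
    (Real.exp_pos _).le).trans ?_
  rw [← Real.exp_add, Real.exp_le_exp]
  have h2 : 4 * (1 / (2 * √(σ : ℝ))) ^ 2 * n ≤ 1 := by
    rw [div_pow, mul_pow, Real.sq_sqrt (by linarith)]
    have : (n : ℝ) ≤ σ := by exact_mod_cast hσ
    field_simp
    linarith
  have h3 : -(1 / (2 * √(σ : ℝ))) * r = -(r / (2 * √σ)) := by ring
  rw [h3]
  linarith

/-- The test function may change with `σ`: the argument is a union bound over `n ≤ σ` and
Borel–Cantelli over `σ`, with no relation needed between scales. -/
theorem eventually_abs_compensatedSum_le (hX : IsAdditionUrn P x X) (hτ₀ : 1 ≤ τ₀)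
    -- The constant `8` makes each tail at most `e (σ + 1)⁻⁴`; the union over at most `σ + 1` times
    -- leaves a summable cube.
    {g : ℕ → (Fin d → ℤ) → ℝ} (hg : ∀ σ v, |g σ v| ≤ 1) :
    ∀ᵐ ω ∂P, ∀ᶠ σ : ℕ in atTop, ∀ n, τ₀ ≤ n → n ≤ σ →
      |compensatedSum X τ₀ (g σ) n ω| ≤ 8 * √σ * Real.log (σ + 1) := by
  set r : ℕ → ℝ := fun σ => 8 * √σ * Real.log (σ + 1) with hr
  set s : ℕ → Set Ω := fun σ => ⋃ n ∈ Finset.Icc τ₀ σ,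
    ({ω | r σ ≤ compensatedSum X τ₀ (g σ) n ω} ∪
      {ω | r σ ≤ compensatedSum X τ₀ (fun v => -g σ v) n ω}) with hs
  have htail : ∀ (f : (Fin d → ℤ) → ℝ), (∀ v, |f v| ≤ 1) → ∀ n σ : ℕ, τ₀ ≤ n → n ≤ σ →
      P {ω | r σ ≤ compensatedSum X τ₀ f n ω} ≤
        ENNReal.ofReal (Real.exp 1 * (((σ : ℝ) + 1) ^ 4)⁻¹) := by
    intro f hf n σ hn hσ
    have h := hX.measureReal_le_compensatedSum hτ₀ hf hn hσ (r σ)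
    rw [← ofReal_measureReal]
    refine ENNReal.ofReal_le_ofReal (h.trans (le_of_eq ?_))
    have hσ1 : (1 : ℝ) ≤ σ := by exact_mod_cast (hτ₀.trans hn).trans hσ
    have hs1 : 0 < √(σ : ℝ) := Real.sqrt_pos.2 (by linarith)
    have e : r σ / (2 * √σ) = Real.log (((σ : ℝ) + 1) ^ 4) := by
      rw [Real.log_pow, hr]
      field_simp
      push_cast
      ring
    rw [e, sub_eq_add_neg, Real.exp_add, Real.exp_neg, Real.exp_log (by positivity)]
  have hsum : ∑' σ, P (s σ) ≠ ∞ := by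
    have hle : ∀ σ, P (s σ) ≤ ENNReal.ofReal (2 * Real.exp 1 * (1 / ((σ + 1 : ℕ) : ℝ) ^ 3)) := by
      intro σ
      refine (measure_biUnion_finset_le _ _).trans ?_
      have h1 : ∀ n ∈ Finset.Icc τ₀ σ, P ({ω | r σ ≤ compensatedSum X τ₀ (g σ) n ω} ∪
          {ω | r σ ≤ compensatedSum X τ₀ (fun v => -g σ v) n ω}) ≤
          ENNReal.ofReal (2 * Real.exp 1 * (((σ : ℝ) + 1) ^ 4)⁻¹) := by
        intro n hn
        rw [Finset.mem_Icc] at hn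
        refine (measure_union_le _ _).trans ((add_le_add (htail _ (hg σ) n σ hn.1 hn.2)
          (htail _ (fun v => by rw [abs_neg]; exact hg σ v) n σ hn.1 hn.2)).trans (le_of_eq ?_))
        rw [← ENNReal.ofReal_add (by positivity) (by positivity)]
        congr 1
        ring
      refine (Finset.sum_le_sum h1).trans ?_
      rw [Finset.sum_const, Nat.card_Icc, nsmul_eq_mul, ← ENNReal.ofReal_natCast,
        ← ENNReal.ofReal_mul (by positivity)]
      refine ENNReal.ofReal_le_ofReal ?_
      have h2 : ((σ + 1 - τ₀ : ℕ) : ℝ) ≤ (σ : ℝ) + 1 := by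
        have : σ + 1 - τ₀ ≤ σ + 1 := by omega
        exact_mod_cast this
      refine (mul_le_mul_of_nonneg_right h2 (by positivity)).trans (le_of_eq ?_)
      push_cast
      field_simp
    refine ne_top_of_le_ne_top ?_ (ENNReal.tsum_le_tsum hle)
    refine Summable.tsum_ofReal_ne_top (Summable.mul_left _ ?_)
    exact (summable_nat_add_iff 1).2 (Real.summable_one_div_nat_pow.2 (by norm_num))
  filter_upwards [ae_eventually_notMem hsum] with ω hω
  filter_upwards [hω] with σ h n h1 h2
  simp only [hs, Set.mem_iUnion, Set.mem_union, Set.mem_ofPred_eq, not_exists, not_or, not_le,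
    Finset.mem_Icc] at h
  obtain ⟨h3, h4⟩ := h n ⟨h1, h2⟩
  rw [compensatedSum_neg] at h4
  exact abs_le.2 ⟨by linarith, h3.le⟩

end IsAdditionUrn

/-! ### The deterministic quadratic recursion and its initial condition. -/

section Recursion

open Complex

theorem one_le_norm_one_sub_I_mul (c : ℝ) : 1 ≤ ‖1 - I * (c : ℂ)‖ := by
  have h := Complex.abs_re_le_norm (1 - I * (c : ℂ))
  simpa using h

theorem one_sub_I_mul_ne_zero (c : ℝ) : 1 - I * (c : ℂ) ≠ 0 :=
  norm_pos_iff.1 (zero_lt_one.trans_le (one_le_norm_one_sub_I_mul c))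

theorem norm_inv_one_sub_I_mul_le (c : ℝ) : ‖(1 - I * (c : ℂ))⁻¹‖ ≤ 1 := by
  rw [norm_inv]
  exact inv_le_one_of_one_le₀ (one_le_norm_one_sub_I_mul c)

/-- Stability of the recursion `H (n + 1) = H n + (H n / n) ^ 2 + noise`, compared with the solution
`n / (1 - i b n)` of the differential equation `h' = (h / t) ^ 2`. -/
theorem norm_sub_le_of_quadratic_recursion {H D : ℕ → ℂ} {b c r : ℝ} {n₀ N : ℕ} (hn₀ : 1 ≤ n₀)
    (hN : n₀ ≤ N) (hc : |b| * N ≤ c) (hH : ∀ n, ‖H n‖ ≤ n)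
    (hstep : ∀ n, n₀ ≤ n → H (n + 1) = H n + (H n / n) ^ 2 + (D (n + 1) - D n))
    (hD : ∀ n, n₀ ≤ n → n ≤ N → ‖D n - D n₀‖ ≤ r) :
    ‖H N - N * (1 - I * (b * N : ℝ))⁻¹‖ ≤
      r + (‖H n₀ - n₀ * (1 - I * (b * n₀ : ℝ))⁻¹‖ + r + c) *
        ((N : ℝ) * (N + 1) / (n₀ * (n₀ + 1))) := by
  set u : ℕ → ℂ := fun n => (1 - I * (b * n : ℝ))⁻¹ with hu
  -- Subtracting the noise lets it enter only through the size of `D n - D n₀`, not through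
  -- accumulated absolute increments.
  set F : ℕ → ℂ := fun n => H n - n * u n - (D n - D n₀) with hF
  have hu1 : ∀ n, ‖u n‖ ≤ 1 := fun n => norm_inv_one_sub_I_mul_le _
  have hr : 0 ≤ r := (norm_nonneg _).trans (hD n₀ le_rfl hN)
  have hc0 : 0 ≤ c := (by positivity : 0 ≤ |b| * N).trans hc
  have hn₀' : (0 : ℝ) < n₀ := by exact_mod_cast hn₀
  have key : ∀ n, n₀ ≤ n → n ≤ N → ‖F n‖ + r + c ≤
      (‖F n₀‖ + r + c) * ((n : ℝ) * (n + 1) / (n₀ * (n₀ + 1))) := by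
    intro n hn
    induction n, hn using Nat.le_induction with
    | base =>
      intro _
      rw [div_self (by positivity), mul_one]
    | succ n hn ih =>
      intro hnN
      have ih := ih (by omega)
      have hn1 : (0 : ℝ) < n := by exact_mod_cast hn₀.trans hn
      have hnc : (n : ℂ) ≠ 0 := by exact_mod_cast hn1.ne'
      have hw1 := one_sub_I_mul_ne_zero (b * n)
      have hw2 := one_sub_I_mul_ne_zero (b * (n + 1 : ℕ))
      have hdiff : u (n + 1) - u n = u n * u (n + 1) * (I * b) := by
        simp only [hu]
        field_simp
        push_cast
        ring
      -- The comparison sequence has increment `u n * u (n + 1)` instead of `u n ^ 2`; the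
      -- discrepancy has norm at most `|b| ≤ c / n`.
      have hUdiff : (n + 1 : ℕ) * u (n + 1) - n * u n = u n * u (n + 1) := by
        simp only [hu]
        field_simp
        push_cast
        ring
      have hrec : F (n + 1) = F n + ((H n / n + u n) * (F n + (D n - D n₀)) / n -
          u n * (u (n + 1) - u n)) := by
        have e1 : F (n + 1) = F n + ((H n / n) ^ 2 - ((n + 1 : ℕ) * u (n + 1) - n * u n)) := by
          simp only [hF, hstep n hn]
          ring
        rw [e1, hUdiff]
        have e2 : F n + (D n - D n₀) = H n - n * u n := by simp only [hF]; ring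
        rw [e2]
        field_simp
        ring
      have hb1 : ‖H n / n + u n‖ ≤ 2 := by
        have : ‖H n / n‖ ≤ 1 := by
          rw [norm_div, Complex.norm_natCast, div_le_one hn1]
          exact hH n
        linarith [norm_add_le (H n / n) (u n), hu1 n]
      have hb2 : ‖F n + (D n - D n₀)‖ ≤ ‖F n‖ + r :=
        (norm_add_le _ _).trans (add_le_add_right (hD n hn (by omega)) _)
      have hb3 : ‖u n * (u (n + 1) - u n)‖ ≤ c / n := by
        rw [hdiff, le_div_iff₀ hn1]
        simp only [norm_mul, Complex.norm_I, one_mul, Complex.norm_real, Real.norm_eq_abs]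
        have hnN' : (n : ℝ) ≤ N := by exact_mod_cast (by omega : n ≤ N)
        have h1 : ‖u n‖ * (‖u n‖ * ‖u (n + 1)‖ * |b|) ≤ 1 * (1 * 1 * |b|) := by
          gcongr <;> exact hu1 _
        calc ‖u n‖ * (‖u n‖ * ‖u (n + 1)‖ * |b|) * n ≤ 1 * (1 * 1 * |b|) * N := by gcongr
          _ ≤ c := by simpa using hc
      have hb4 : ‖(H n / n + u n) * (F n + (D n - D n₀)) / n‖ ≤ 2 * (‖F n‖ + r) / n := by
        rw [norm_div, norm_mul, Complex.norm_natCast]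
        gcongr
      have hb5 : ‖F (n + 1)‖ ≤ ‖F n‖ + (2 * (‖F n‖ + r) / n + c / n) := by
        rw [hrec]
        refine (norm_add_le _ _).trans (add_le_add_right ((norm_sub_le _ _).trans ?_) _)
        exact add_le_add hb4 hb3
      -- Adding `r + c` makes the inequality homogeneous, and the factors `(n + 2) / n` telescope.
      have hb6 : ‖F (n + 1)‖ + r + c ≤ (‖F n‖ + r + c) * ((n + 2) / n) := by
        have e : (‖F n‖ + r + c) * (((n : ℝ) + 2) / n) =
            ‖F n‖ + (2 * (‖F n‖ + r) / n + c / n) + r + c + c / n := by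
          field_simp
          ring
        rw [e]
        have : 0 ≤ c / n := by positivity
        linarith
      refine hb6.trans ((mul_le_mul_of_nonneg_right ih (by positivity)).trans (le_of_eq ?_))
      push_cast
      field_simp
      ring
  have h1 := key N hN le_rfl
  have h2 : F n₀ = H n₀ - n₀ * u n₀ := by simp [hF]
  rw [h2] at h1
  have h3 : H N - N * u N = F N + (D N - D n₀) := by simp only [hF]; ring
  change ‖H N - N * u N‖ ≤ _
  rw [h3]
  refine (norm_add_le _ _).trans ?_
  linarith [hD N hN le_rfl]

/-- Taylor's bound for `|y| ≤ 1`, the trivial `2 + |y| ≤ 3y²` beyond: no smallness is required of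
the rescaled labels. -/
theorem norm_exp_I_mul_sub_le (y : ℝ) : ‖exp (I * y) - 1 - I * y‖ ≤ 3 * y ^ 2 := by
  rcases le_or_gt |y| 1 with h | h
  · have h1 : ‖I * (y : ℂ)‖ = |y| := by simp
    have h2 := Complex.norm_exp_sub_one_sub_id_le (x := I * y) (by rw [h1]; exact h)
    rw [h1, sq_abs] at h2
    nlinarith [sq_nonneg y]
  · have h1 : ‖exp (I * (y : ℂ))‖ = 1 := by rw [mul_comm]; exact Complex.norm_exp_ofReal_mul_I y
    have h2 : ‖exp (I * (y : ℂ)) - 1 - I * y‖ ≤ 1 + 1 + |y| := by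
      refine (norm_sub_le _ _).trans (add_le_add ((norm_sub_le _ _).trans ?_) ?_)
      · rw [h1]; simp
      · simp
    rw [← sq_abs]
    nlinarith

/-- Second order comparison of the exponential sums of `Y` with `n / (1 - i c n / σ)`. -/
theorem norm_sum_exp_sub_le (Y : ℕ → ℝ) (c : ℝ) {σ : ℝ} (hσ : 0 < σ) (n : ℕ) :
    ‖∑ k ∈ Finset.Icc 1 n, exp (I * (Y k / σ : ℝ)) - n * (1 - I * (c / σ * n : ℝ))⁻¹‖ ≤
      3 * (∑ k ∈ Finset.Icc 1 n, Y k ^ 2) / σ ^ 2 +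
        |∑ k ∈ Finset.Icc 1 n, Y k - c * n ^ 2| / σ + c ^ 2 * n ^ 3 / σ ^ 2 := by
  have hw := one_sub_I_mul_ne_zero (c / σ * n)
  have hσc : (σ : ℂ) ≠ 0 := by exact_mod_cast hσ.ne'
  set w : ℂ := 1 - I * (c / σ * n : ℝ) with hwdef
  -- With `z = i c n / σ`, use `1/(1 - z) = 1 + z + z²/(1 - z)`. What remains is the Taylor
  -- remainder, the error in the first moment and the `z²` term.
  have e1 : ∑ k ∈ Finset.Icc 1 n, exp (I * (Y k / σ : ℝ)) - n * w⁻¹ =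
      ∑ k ∈ Finset.Icc 1 n, (exp (I * (Y k / σ : ℝ)) - 1 - I * (Y k / σ : ℝ)) +
        I * ((∑ k ∈ Finset.Icc 1 n, Y k - c * n ^ 2) / σ : ℝ) -
        n * (I * (c / σ * n : ℝ)) ^ 2 * w⁻¹ := by
    have e2 : n * (I * (c / σ * n : ℝ)) ^ 2 * w⁻¹ = n * w⁻¹ - n - n * (I * (c / σ * n : ℝ)) := by
      have : I * (c / σ * n : ℝ) = 1 - w := by rw [hwdef]; ring
      rw [this]
      field_simp
    rw [e2]
    simp only [Finset.sum_sub_distrib, Finset.sum_const, Nat.card_Icc, ← Finset.mul_sum]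
    push_cast
    rw [← Finset.sum_div, nsmul_eq_mul]
    field_simp
    ring
  rw [e1]
  refine (norm_sub_le _ _).trans (add_le_add ((norm_add_le _ _).trans (add_le_add ?_ ?_)) ?_)
  · refine (norm_sum_le _ _).trans ((Finset.sum_le_sum fun k _ => norm_exp_I_mul_sub_le _).trans
      (le_of_eq ?_))
    rw [mul_div_assoc, Finset.sum_div, Finset.mul_sum]
    exact Finset.sum_congr rfl fun k _ => by rw [div_pow]
  · rw [norm_mul, Complex.norm_I, one_mul, Complex.norm_real, Real.norm_eq_abs, abs_div,
      abs_of_pos hσ]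
  · rw [norm_mul, norm_mul, norm_pow, norm_mul, Complex.norm_I, one_mul, Complex.norm_real,
      Complex.norm_natCast, Real.norm_eq_abs, sq_abs]
    refine (mul_le_of_le_one_right (by positivity) (norm_inv_one_sub_I_mul_le _)).trans
      (le_of_eq ?_)
    field_simp

end Recursion

/-! ### Choice of scales and limit of the exponential sums. -/

theorem exists_pow_sixteen_le (n : ℕ) : ∃ m : ℕ, m ^ 16 ≤ n ∧ n < (m + 1) ^ 16 := by
  have h : ∃ m : ℕ, n < (m + 1) ^ 16 := ⟨n, (Nat.lt_succ_self n).trans_le (Nat.le_self_pow (by norm_num) _)⟩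
  refine ⟨Nat.find h, ?_, Nat.find_spec h⟩
  rcases Nat.eq_zero_or_pos (Nat.find h) with h0 | h0
  · rw [h0]; simp
  · have := Nat.find_min h (Nat.sub_lt h0 one_pos)
    rw [Nat.sub_add_cancel (show 1 ≤ Nat.find h from h0)] at this
    exact not_lt.1 this

/-- With `s ≈ m^16` and start `m^13`, the magnification is of order `m^6`. Noise of order `m^9`
(`m^8` from `√s`, at most `m` from the logarithm) becomes `m^15`, one power below `s`. The `Q` term
is `m^15` times `Q / m^41`, and the first-moment error stays proportional to `s` with a vanishing
coefficient. -/
theorem scale_error_le {m s Q S c r E a : ℝ} (hm1 : 1 ≤ m) (hs1 : m ^ 16 ≤ s)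
    (hsm : s ≤ (2 * m) ^ 16) (hr0 : 0 ≤ r) (hrm : r ≤ 512 * (2 * m) ^ 9) (hQ0 : 0 ≤ Q)
    (hE0 : 0 ≤ E)
    (hE : E ≤ 3 * Q / s ^ 2 + |S - c * (m ^ 13) ^ 2| / s + c ^ 2 * (m ^ 13) ^ 3 / s ^ 2)
    (ha : a ≤ s ^ 2 / (m ^ 13) ^ 2) :
    r + (E + r + |c|) * a ≤ (3 * (Q / m ^ 41) + |S / (m ^ 13) ^ 2 - c| +
        (c ^ 2 + |c| * 2 ^ 16 + 1024 * 2 ^ 25) / m) * s := by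
  have hm0 : 0 < m := by linarith
  have hs0 : 0 < s := lt_of_lt_of_le (by positivity) hs1
  have t1 : 3 * Q / s ^ 2 * (s ^ 2 / (m ^ 13) ^ 2) ≤ 3 * (Q / m ^ 41) * s := by
    calc 3 * Q / s ^ 2 * (s ^ 2 / (m ^ 13) ^ 2) = 3 * (Q / m ^ 41) * m ^ 15 := by
          field_simp
      _ ≤ 3 * (Q / m ^ 41) * s := by
          gcongr
          exact (pow_le_pow_right₀ hm1 (by norm_num)).trans hs1
  have t2 : |S - c * (m ^ 13) ^ 2| / s * (s ^ 2 / (m ^ 13) ^ 2) =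
      |S / (m ^ 13) ^ 2 - c| * s := by
    have e : S / (m ^ 13) ^ 2 - c = (S - c * (m ^ 13) ^ 2) / (m ^ 13) ^ 2 := by
      field_simp
    rw [e, abs_div, abs_of_pos (by positivity : (0 : ℝ) < (m ^ 13) ^ 2)]
    field_simp
  have t3 : c ^ 2 * (m ^ 13) ^ 3 / s ^ 2 * (s ^ 2 / (m ^ 13) ^ 2) ≤ c ^ 2 / m * s := by
    calc c ^ 2 * (m ^ 13) ^ 3 / s ^ 2 * (s ^ 2 / (m ^ 13) ^ 2) = c ^ 2 / m * m ^ 14 := by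
          field_simp
      _ ≤ c ^ 2 / m * s := by
          gcongr
          exact (pow_le_pow_right₀ hm1 (by norm_num)).trans hs1
  have t4 : r * (s ^ 2 / (m ^ 13) ^ 2) ≤ 512 * 2 ^ 25 / m * s := by
    calc r * (s ^ 2 / (m ^ 13) ^ 2) = r * s / (m ^ 13) ^ 2 * s := by ring
      _ ≤ 512 * (2 * m) ^ 9 * (2 * m) ^ 16 / (m ^ 13) ^ 2 * s := by gcongr
      _ = 512 * 2 ^ 25 / m * s := by
          field_simp
  have t5 : |c| * (s ^ 2 / (m ^ 13) ^ 2) ≤ |c| * 2 ^ 16 / m * s := by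
    calc |c| * (s ^ 2 / (m ^ 13) ^ 2) = |c| * s / (m ^ 13) ^ 2 * s := by ring
      _ ≤ |c| * (2 * m) ^ 16 / (m ^ 13) ^ 2 * s := by gcongr
      _ = |c| * 2 ^ 16 / m * s * (1 / m ^ 9) := by
          field_simp
      _ ≤ |c| * 2 ^ 16 / m * s := by
          refine mul_le_of_le_one_right (by positivity) ?_
          rw [div_le_one (by positivity)]
          exact one_le_pow₀ hm1
  -- The noise counts twice, once magnified and once added at the end; hence `1024 = 2 * 512`.
  have t6 : r ≤ r * (s ^ 2 / (m ^ 13) ^ 2) := by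
    refine le_mul_of_one_le_right hr0 ?_
    rw [one_le_div (by positivity)]
    have : m ^ 13 ≤ s := (pow_le_pow_right₀ hm1 (by norm_num)).trans hs1
    gcongr
  have step1 := mul_le_mul_of_nonneg_left ha (by positivity : 0 ≤ E + r + |c|)
  have step2 := mul_le_mul_of_nonneg_right (add_le_add_left (add_le_add_left hE r) |c|)
    (by positivity : 0 ≤ s ^ 2 / (m ^ 13) ^ 2)
  have e7 : (c ^ 2 + |c| * 2 ^ 16 + 1024 * 2 ^ 25) / m * s =
      c ^ 2 / m * s + |c| * 2 ^ 16 / m * s + 512 * 2 ^ 25 / m * s + 512 * 2 ^ 25 / m * s := by ring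
  refine (add_le_add_right (step1.trans step2) r).trans ?_
  rw [add_mul (_ + _) _ s, add_mul _ _ s, e7, add_mul, add_mul, add_mul, add_mul, t2]
  linarith

theorem mul_div_mul_le_sq_div_sq {s M : ℝ} (hs : 1 ≤ s) (hM : 0 < M) :
    (s - 1) * (s - 1 + 1) / (M * (M + 1)) ≤ s ^ 2 / M ^ 2 := by
  refine div_le_div₀ (by positivity) ?_ (by positivity) ?_ <;> nlinarith

theorem noise_bound_le {m s : ℝ} (hm1 : 1 ≤ m) (hs0 : 0 ≤ s) (hs : s + 1 ≤ (m + 1) ^ 16) :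
    0 ≤ 32 * √s * Real.log (s + 1) ∧ 32 * √s * Real.log (s + 1) ≤ 512 * (2 * m) ^ 9 ∧
      s ≤ (2 * m) ^ 16 := by
  have hlog0 : 0 ≤ Real.log (s + 1) := Real.log_nonneg (by linarith)
  have hlog : Real.log (s + 1) ≤ 16 * (m + 1) := by
    calc Real.log (s + 1) ≤ Real.log ((m + 1) ^ 16) := Real.log_le_log (by positivity) hs
      _ = 16 * Real.log (m + 1) := by rw [Real.log_pow]; norm_num
      _ ≤ 16 * (m + 1) := by
        have := Real.log_le_sub_one_of_pos (by positivity : 0 < m + 1)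
        linarith
  have hsqrt : √s ≤ (m + 1) ^ 8 := by
    rw [Real.sqrt_le_left (by positivity), ← pow_mul]
    norm_num
    linarith
  have hm2 : m + 1 ≤ 2 * m := by linarith
  refine ⟨by positivity, ?_, ?_⟩
  · calc 32 * √s * Real.log (s + 1) ≤ 32 * (m + 1) ^ 8 * (16 * (m + 1)) := by gcongr
      _ = 512 * (m + 1) ^ 9 := by ring
      _ ≤ 512 * (2 * m) ^ 9 := by gcongr
  · have : (m + 1) ^ 16 ≤ (2 * m) ^ 16 := by gcongr
    linarith

section Limit

open Complex

variable {Y : ℕ → ℝ} {c : ℝ} {D : ℕ → ℕ → ℂ} {τ₀ : ℕ}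

/-- The error of the exponential sums at scale `s`, in terms of the sixteenth root `m` of `s`. -/
theorem norm_sum_exp_sub_le_of_pow
    (hstep : ∀ s n : ℕ, τ₀ ≤ n →
      ∑ k ∈ Finset.Icc 1 (n + 1), exp (I * (Y k / s : ℝ)) =
        ∑ k ∈ Finset.Icc 1 n, exp (I * (Y k / s : ℝ)) +
          ((∑ k ∈ Finset.Icc 1 n, exp (I * (Y k / s : ℝ))) / n) ^ 2 + (D s (n + 1) - D s n))
    {m s : ℕ} (hm : 2 ≤ m) (hτ : τ₀ ≤ m) (h1 : m ^ 16 ≤ s) (h2 : s < (m + 1) ^ 16)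
    (hD : ∀ n, τ₀ ≤ n → n ≤ s → ‖D s n‖ ≤ 16 * √s * Real.log (s + 1)) :
    ‖∑ k ∈ Finset.Icc 1 (s - 1), exp (I * (Y k / s : ℝ)) -
        (s - 1 : ℕ) * (1 - I * (c / s * (s - 1 : ℕ) : ℝ))⁻¹‖ / s ≤
      3 * ((∑ k ∈ Finset.Icc 1 (m ^ 13), Y k ^ 2) / (m : ℝ) ^ 41) +
        |(∑ k ∈ Finset.Icc 1 (m ^ 13), Y k) / ((m : ℝ) ^ 13) ^ 2 - c| +
        (c ^ 2 + |c| * 2 ^ 16 + 1024 * 2 ^ 25) / m := by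
  have hm1 : (1 : ℝ) ≤ m := by exact_mod_cast (by omega : 1 ≤ m)
  have hm0 : (0 : ℝ) < m := by linarith
  have hs1 : (m : ℝ) ^ 16 ≤ s := by exact_mod_cast h1
  have hs2 : (s : ℝ) + 1 ≤ ((m : ℝ) + 1) ^ 16 := by exact_mod_cast h2
  have hs0 : (0 : ℝ) < s := lt_of_lt_of_le (by positivity) hs1
  have hm13 : 1 ≤ m ^ 13 := Nat.one_le_pow _ _ (by omega)
  have hms : m ^ 13 ≤ s - 1 := by
    have : m ^ 13 * 2 ^ 3 ≤ m ^ 13 * m ^ 3 := Nat.mul_le_mul_left _ (Nat.pow_le_pow_left hm 3)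
    have e : m ^ 13 * m ^ 3 = m ^ 16 := by ring
    omega
  have hτ13 : τ₀ ≤ m ^ 13 := hτ.trans (Nat.le_self_pow (by norm_num) m)
  have hscast : ((s - 1 : ℕ) : ℝ) = s - 1 := by
    rw [Nat.cast_sub (by omega)]; simp
  -- Twice the bound on `D`, because the recursion measures the noise relative to its value at the
  -- start.
  set r : ℝ := 32 * √s * Real.log (s + 1) with hr
  obtain ⟨hr0, hrm, hsm⟩ := noise_bound_le hm1 hs0.le hs2
  have hrec := norm_sub_le_of_quadratic_recursion
    (H := fun n => ∑ k ∈ Finset.Icc 1 n, exp (I * (Y k / s : ℝ))) (D := D s) (b := c / s)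
    (c := |c|) (r := r) hm13 hms
    (by
      rw [abs_div, abs_of_pos hs0, hscast, div_mul_eq_mul_div, div_le_iff₀ hs0]
      exact mul_le_mul_of_nonneg_left (by linarith) (abs_nonneg c))
    (fun n => by
      refine (norm_sum_le _ _).trans (le_of_eq ?_)
      have : ∀ y : ℝ, ‖exp (I * (y : ℂ))‖ = 1 := fun y => by
        rw [mul_comm]; exact Complex.norm_exp_ofReal_mul_I y
      simp only [this, Finset.sum_const, Nat.card_Icc, nsmul_eq_mul, mul_one, Nat.add_sub_cancel])
    (fun n hn => hstep s n (hτ13.trans hn))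
    (fun n hn hn' => by
      refine (norm_sub_le _ _).trans ((add_le_add (hD n (hτ13.trans hn) (by omega))
        (hD _ hτ13 (by omega))).trans (le_of_eq ?_))
      rw [hr]; ring)
  have hinit := norm_sum_exp_sub_le Y c hs0 (m ^ 13)
  set Q := ∑ k ∈ Finset.Icc 1 (m ^ 13), Y k ^ 2 with hQ
  set S := ∑ k ∈ Finset.Icc 1 (m ^ 13), Y k with hS
  have hQ0 : 0 ≤ Q := Finset.sum_nonneg fun _ _ => sq_nonneg _
  have hratio : ((s - 1 : ℕ) : ℝ) * ((s - 1 : ℕ) + 1) / ((m ^ 13 : ℕ) * ((m ^ 13 : ℕ) + 1)) ≤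
      (s : ℝ) ^ 2 / ((m : ℝ) ^ 13) ^ 2 := by
    rw [hscast, Nat.cast_pow]
    exact mul_div_mul_le_sq_div_sq ((one_le_pow₀ hm1).trans hs1) (pow_pos hm0 13)
  rw [div_le_iff₀ hs0]
  refine hrec.trans (scale_error_le hm1 hs1 hsm hr0 hrm hQ0 (norm_nonneg _) ?_ hratio)
  rw [← Nat.cast_pow (α := ℝ) m]
  exact hinit

theorem tendsto_sum_exp
    (hS : Tendsto (fun n : ℕ => ((n : ℝ) * (n + 1))⁻¹ * ∑ k ∈ Finset.Icc 1 n, Y k) atTop (𝓝 c))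
    (hQ : Tendsto (fun m : ℕ => (∑ k ∈ Finset.Icc 1 (m ^ 13), Y k ^ 2) / (m : ℝ) ^ 41) atTop (𝓝 0))
    (hstep : ∀ s n : ℕ, τ₀ ≤ n →
      ∑ k ∈ Finset.Icc 1 (n + 1), exp (I * (Y k / s : ℝ)) =
        ∑ k ∈ Finset.Icc 1 n, exp (I * (Y k / s : ℝ)) +
          ((∑ k ∈ Finset.Icc 1 n, exp (I * (Y k / s : ℝ))) / n) ^ 2 + (D s (n + 1) - D s n))
    (hD : ∀ᶠ s : ℕ in atTop, ∀ n, τ₀ ≤ n → n ≤ s →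
      ‖D s n‖ ≤ 16 * √s * Real.log (s + 1)) :
    Tendsto (fun n : ℕ => (n : ℂ)⁻¹ * ∑ k ∈ Finset.Icc 1 n, exp (I * (Y k / (n + 1 : ℕ) : ℝ))) atTop
      (𝓝 (1 - I * c)⁻¹) := by
  choose m hm1 hm2 using exists_pow_sixteen_le
  have hm : Tendsto m atTop atTop := by
    refine tendsto_atTop.2 fun b => ?_
    filter_upwards [eventually_ge_atTop (b ^ 16)] with s hs
    by_contra hc
    have h1 : (m s + 1) ^ 16 ≤ b ^ 16 := Nat.pow_le_pow_left (by omega) 16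
    exact absurd ((hm2 s).trans_le h1) (by omega)
  have hS' : Tendsto (fun n : ℕ => |(∑ k ∈ Finset.Icc 1 n, Y k) / (n : ℝ) ^ 2 - c|) atTop (𝓝 0) := by
    have h1 : Tendsto (fun n : ℕ => (1 + 1 / (n : ℝ)) *
        (((n : ℝ) * (n + 1))⁻¹ * ∑ k ∈ Finset.Icc 1 n, Y k) - c) atTop (𝓝 ((1 + 0) * c - c)) :=
      (((tendsto_one_div_atTop_nhds_zero_nat (𝕜 := ℝ)).const_add 1).mul hS).sub_const c
    have h2 := h1.abs
    rw [add_zero, one_mul, sub_self, abs_zero] at h2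
    refine h2.congr' ?_
    filter_upwards [eventually_ge_atTop 1] with n hn
    have hn' : (n : ℝ) ≠ 0 := by positivity
    congr 2
    field_simp
  have h13 : Tendsto (fun j : ℕ => j ^ 13) atTop atTop := tendsto_pow_atTop (by norm_num)
  have hB : Tendsto (fun j : ℕ => 3 * ((∑ k ∈ Finset.Icc 1 (j ^ 13), Y k ^ 2) / (j : ℝ) ^ 41) +
        |(∑ k ∈ Finset.Icc 1 (j ^ 13), Y k) / ((j : ℝ) ^ 13) ^ 2 - c| +
        (c ^ 2 + |c| * 2 ^ 16 + 1024 * 2 ^ 25) / j) atTop (𝓝 0) := by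
    have h1 := ((hQ.const_mul 3).add (hS'.comp h13)).add
      (tendsto_const_div_atTop_nhds_zero_nat (c ^ 2 + |c| * 2 ^ 16 + 1024 * 2 ^ 25))
    simp only [mul_zero, add_zero] at h1
    refine h1.congr fun j => ?_
    simp
  have hE := hB.comp hm
  have hE2 : Tendsto (fun s : ℕ => ‖∑ k ∈ Finset.Icc 1 (s - 1), exp (I * (Y k / s : ℝ)) -
        (s - 1 : ℕ) * (1 - I * (c / s * (s - 1 : ℕ) : ℝ))⁻¹‖ / s) atTop (𝓝 0) := by
    refine squeeze_zero' (Eventually.of_forall fun s => by positivity) ?_ hE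
    filter_upwards [hm.eventually_ge_atTop 2, hm.eventually_ge_atTop τ₀, hD] with s g1 g2 g3
    exact norm_sum_exp_sub_le_of_pow hstep g1 g2 (hm1 s) (hm2 s) g3
  have hE3 := (tendsto_add_atTop_iff_nat 1).2 hE2
  simp only [Nat.add_sub_cancel] at hE3
  -- With `s = n + 1`, this factor replaces the normalization `n + 1` by `n`.
  have hone : Tendsto (fun n : ℕ => 1 + 1 / (n : ℝ)) atTop (𝓝 (1 + 0)) :=
    (tendsto_one_div_atTop_nhds_zero_nat (𝕜 := ℝ)).const_add 1
  have hE4 := hE3.mul hone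
  rw [zero_mul] at hE4
  have hE5 : Tendsto (fun n : ℕ => (n : ℂ)⁻¹ * ∑ k ∈ Finset.Icc 1 n, exp (I * (Y k / (n + 1 : ℕ) : ℝ)) -
      (1 - I * (c / (n + 1 : ℕ) * n : ℝ))⁻¹) atTop (𝓝 0) := by
    rw [tendsto_zero_iff_norm_tendsto_zero]
    refine hE4.congr' ?_
    filter_upwards [eventually_ge_atTop 1] with n hn
    have hn' : (0 : ℝ) < n := by exact_mod_cast hn
    have hnc : (n : ℂ) ≠ 0 := by exact_mod_cast hn'.ne'
    set a := ∑ k ∈ Finset.Icc 1 n, exp (I * (Y k / (n + 1 : ℕ) : ℝ)) with ha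
    set b := (1 - I * (c / (n + 1 : ℕ) * n : ℝ))⁻¹ with hb
    have e : (n : ℂ)⁻¹ * a - b = (n : ℂ)⁻¹ * (a - n * b) := by
      rw [mul_sub, ← mul_assoc, inv_mul_cancel₀ hnc, one_mul]
    rw [e, norm_mul, norm_inv, Complex.norm_natCast]
    push_cast
    field_simp
  have hU : Tendsto (fun n : ℕ => (1 - I * (c / (n + 1 : ℕ) * n : ℝ))⁻¹) atTop
      (𝓝 (1 - I * (c : ℂ))⁻¹) := by
    have h1 : Tendsto (fun n : ℕ => c / (n + 1 : ℕ) * n) atTop (𝓝 (c * 1)) := by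
      refine (tendsto_natCast_div_add_atTop (1 : ℝ) |>.const_mul c).congr fun n => ?_
      push_cast
      ring
    rw [mul_one] at h1
    have h2 : Tendsto (fun n : ℕ => ((c / (n + 1 : ℕ) * n : ℝ) : ℂ)) atTop (𝓝 (c : ℂ)) :=
      (Complex.continuous_ofReal.tendsto c).comp h1
    exact ((h2.const_mul I).const_sub 1).inv₀ (one_sub_I_mul_ne_zero c)
  have := hE5.add hU
  simpa using this

end Limit

/-! ### Almost sure convergence for one additive functional. -/

/-- Nonnegative functions with summable integrals tend to zero almost everywhere. -/
theorem ae_tendsto_zero_of_summable_integral {Ω : Type*} [MeasurableSpace Ω] {P : Measure Ω}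
    {f : ℕ → Ω → ℝ} (hf : ∀ m, Integrable (f m) P) (h0 : ∀ m ω, 0 ≤ f m ω)
    (hs : Summable fun m => ∫ ω, f m ω ∂P) :
    ∀ᵐ ω ∂P, Tendsto (fun m => f m ω) atTop (𝓝 0) := by
  have hm : ∀ m, AEMeasurable (fun ω => ENNReal.ofReal (f m ω)) P := fun m =>
    (hf m).aemeasurable.ennreal_ofReal
  have h1 : ∫⁻ ω, ∑' m, ENNReal.ofReal (f m ω) ∂P ≠ ∞ := by
    rw [lintegral_tsum hm]
    have e : ∀ m, ∫⁻ ω, ENNReal.ofReal (f m ω) ∂P = ENNReal.ofReal (∫ ω, f m ω ∂P) := fun m =>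
      (ofReal_integral_eq_lintegral_ofReal (hf m) (ae_of_all _ (h0 m))).symm
    simp_rw [e]
    exact hs.tsum_ofReal_ne_top
  filter_upwards [ae_lt_top' (AEMeasurable.tsum hm) h1] with ω hω
  have h2 := ENNReal.tendsto_atTop_zero_of_tsum_ne_top hω.ne
  have h3 := (ENNReal.tendsto_toReal ENNReal.zero_ne_top).comp h2
  refine h3.congr fun m => ?_
  simp [ENNReal.toReal_ofReal (h0 m ω)]

/-- The complex compensated sums of `exp (i ℓ / s)`. -/
noncomputable def expCompensatedSum {Ω : Type*} {d : ℕ} (X : ℕ → Ω → Fin d → ℤ) (τ₀ : ℕ)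
    (ℓ : (Fin d → ℤ) →+ ℝ) (ω : Ω) (s n : ℕ) : ℂ :=
  compensatedSum X τ₀ (fun v => Real.cos (ℓ v / s)) n ω +
    Complex.I * compensatedSum X τ₀ (fun v => Real.sin (ℓ v / s)) n ω

theorem exp_I_mul_ofReal (y : ℝ) :
    Complex.exp (Complex.I * y) = Real.cos y + Complex.I * Real.sin y := by
  rw [mul_comm, Complex.exp_mul_I, Complex.ofReal_cos, Complex.ofReal_sin]
  ring

/-- The exponential turns the sum of two labels into a product, so its mean over pairs is the square
of its mean over labels. -/
theorem drawMean_cos_add_sin {Ω : Type*} {d : ℕ} (X : ℕ → Ω → Fin d → ℤ) (ℓ : (Fin d → ℤ) →+ ℝ)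
    (s n : ℕ) (ω : Ω) :
    (drawMean X (fun v => Real.cos (ℓ v / s)) n ω : ℂ) +
        Complex.I * drawMean X (fun v => Real.sin (ℓ v / s)) n ω =
      ((∑ k ∈ Finset.Icc 1 n, Complex.exp (Complex.I * (ℓ (X k ω) / s : ℝ))) / n) ^ 2 := by
  have h1 : (∑ k ∈ Finset.Icc 1 n, Complex.exp (Complex.I * (ℓ (X k ω) / s : ℝ))) ^ 2 =
      ∑ j ∈ Finset.Icc 1 n, ∑ k ∈ Finset.Icc 1 n,
        ((Real.cos (ℓ (X j ω + X k ω) / s) : ℂ) +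
          Complex.I * (Real.sin (ℓ (X j ω + X k ω) / s) : ℝ)) := by
    rw [pow_two, Finset.sum_mul_sum]
    refine Finset.sum_congr rfl fun j _ => Finset.sum_congr rfl fun k _ => ?_
    rw [← exp_I_mul_ofReal, ← Complex.exp_add, map_add]
    congr 1
    push_cast
    ring
  rw [div_pow, h1]
  simp only [drawMean, Finset.sum_add_distrib, ← Finset.mul_sum]
  push_cast
  ring

theorem expCompensatedSum_step {Ω : Type*} {d : ℕ} (X : ℕ → Ω → Fin d → ℤ) (τ₀ : ℕ)
    (ℓ : (Fin d → ℤ) →+ ℝ) (ω : Ω) (s n : ℕ) (hn : τ₀ ≤ n) :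
    ∑ k ∈ Finset.Icc 1 (n + 1), Complex.exp (Complex.I * (ℓ (X k ω) / s : ℝ)) =
      ∑ k ∈ Finset.Icc 1 n, Complex.exp (Complex.I * (ℓ (X k ω) / s : ℝ)) +
        ((∑ k ∈ Finset.Icc 1 n, Complex.exp (Complex.I * (ℓ (X k ω) / s : ℝ))) / n) ^ 2 +
          (expCompensatedSum X τ₀ ℓ ω s (n + 1) - expCompensatedSum X τ₀ ℓ ω s n) := by
  rw [Finset.sum_Icc_succ_top (by omega), ← drawMean_cos_add_sin, expCompensatedSum,
    expCompensatedSum, compensatedSum_succ X hn, compensatedSum_succ X hn,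
    exp_I_mul_ofReal (ℓ (X (n + 1) ω) / s)]
  push_cast
  ring

namespace IsAdditionUrn

variable {Ω : Type*} [MeasurableSpace Ω] {P : Measure Ω} [IsProbabilityMeasure P]
    {d τ₀ : ℕ} {x : Fin τ₀ → Fin d → ℤ} {X : ℕ → Ω → Fin d → ℤ}

theorem ae_tendsto_labelSum_sq (hX : IsAdditionUrn P x X) (hτ₀ : 1 ≤ τ₀) (ℓ : (Fin d → ℤ) →+ ℝ) :
    ∀ᵐ ω ∂P, Tendsto (fun m : ℕ => labelSum X (fun v => ℓ v ^ 2) (m ^ 13) ω / (m : ℝ) ^ 41)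
      atTop (𝓝 0) := by
  obtain ⟨C, hC0, hC⟩ := hX.exists_integral_labelSum_sq_le hτ₀ ℓ
  have hnn : ∀ n ω, 0 ≤ labelSum X (fun v => ℓ v ^ 2) n ω := fun n ω =>
    labelSum_nonneg X (fun v => sq_nonneg _) n ω
  refine ae_tendsto_zero_of_summable_integral
    (fun m => (hX.integrable_labelSum hτ₀ _ _).div_const _) (fun m ω => div_nonneg (hnn _ _)
      (by positivity)) ?_
  -- The mean of `Q` at time `m^13` is at most a multiple of `m^39`; division by `m^41` leaves the
  -- summable `m⁻²`.
  refine Summable.of_norm_bounded_eventually_nat (g := fun m : ℕ => C * (1 / (m : ℝ) ^ 2))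
    ((Real.summable_one_div_nat_pow.2 (by norm_num)).mul_left C) ?_
  filter_upwards [eventually_ge_atTop τ₀] with m hm
  have hm0 : (0 : ℝ) < m := by exact_mod_cast hτ₀.trans hm
  rw [integral_div, Real.norm_of_nonneg (div_nonneg (integral_nonneg (hnn _)) (by positivity)),
    div_le_iff₀ (by positivity)]
  refine (hC (m ^ 13) (hm.trans (Nat.le_self_pow (by norm_num) m))).trans (le_of_eq ?_)
  rw [Nat.cast_pow]
  field_simp

theorem eventually_norm_expCompensatedSum_le (hX : IsAdditionUrn P x X) (hτ₀ : 1 ≤ τ₀)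
    (ℓ : (Fin d → ℤ) →+ ℝ) :
    ∀ᵐ ω ∂P, ∀ᶠ s : ℕ in atTop, ∀ n, τ₀ ≤ n → n ≤ s →
      ‖expCompensatedSum X τ₀ ℓ ω s n‖ ≤ 16 * √s * Real.log (s + 1) := by
  filter_upwards [hX.eventually_abs_compensatedSum_le hτ₀ (g := fun s v => Real.cos (ℓ v / s))
      (fun s v => Real.abs_cos_le_one _),
    hX.eventually_abs_compensatedSum_le hτ₀ (g := fun s v => Real.sin (ℓ v / s))
      (fun s v => Real.abs_sin_le_one _)] with ω h1 h2
  filter_upwards [h1, h2] with s h3 h4 n hn hns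
  refine (norm_add_le _ _).trans ?_
  rw [norm_mul, Complex.norm_I, one_mul, Complex.norm_real, Complex.norm_real, Real.norm_eq_abs,
    Real.norm_eq_abs]
  linarith [h3 n hn hns, h4 n hn hns]

/-- The rescaled empirical characteristic function converges to the one of an exponential law. -/
theorem ae_tendsto_sum_exp (hX : IsAdditionUrn P x X) (hτ₀ : 1 ≤ τ₀) (ℓ : (Fin d → ℤ) →+ ℝ)
    {A : Ω → ℝ} (hA : ∀ᵐ ω ∂P, Tendsto
      (fun n : ℕ => ((n : ℝ) * (n + 1))⁻¹ * labelSum X ℓ n ω) atTop (𝓝 (A ω))) :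
    ∀ᵐ ω ∂P, Tendsto (fun n : ℕ => (n : ℂ)⁻¹ *
      ∑ k ∈ Finset.Icc 1 n, Complex.exp (Complex.I * (ℓ (X k ω) / (n + 1 : ℕ) : ℝ))) atTop
      (𝓝 (1 - Complex.I * A ω)⁻¹) := by
  filter_upwards [hA, hX.ae_tendsto_labelSum_sq hτ₀ ℓ,
    hX.eventually_norm_expCompensatedSum_le hτ₀ ℓ] with ω h1 h2 h3
  exact tendsto_sum_exp h1 h2 (expCompensatedSum_step X τ₀ ℓ ω) h3

end IsAdditionUrn

/-! ### Characteristic function of the Gamma limit and Lévy's theorem. -/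

section Gamma

/-- An explicit antiderivative is `-(y/w + 1/w²) e^{-wy}`; it decays at infinity since `Re w = 1`,
and its value at `0` gives the result. -/
theorem integral_Ioi_mul_exp_neg_mul {w : ℂ} (hw : w.re = 1) :
    ∫ y in Set.Ioi (0 : ℝ), (y : ℂ) * Complex.exp (-(w * y)) = (w⁻¹) ^ 2 := by
  have hw0 : w ≠ 0 := by rintro rfl; simp at hw
  have hnorm : ∀ y : ℝ, ‖Complex.exp (-(w * y))‖ = Real.exp (-y) := by
    intro y
    rw [Complex.norm_exp]
    simp [hw]
  have hderiv : ∀ y ∈ Set.Ici (0 : ℝ), HasDerivAt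
      (fun y : ℝ => -(w⁻¹ * y + w⁻¹ ^ 2) * Complex.exp (-(w * y)))
      ((y : ℂ) * Complex.exp (-(w * y))) y := by
    intro y _
    have h1 : HasDerivAt (fun y : ℝ => (y : ℂ)) 1 y := Complex.ofRealCLM.hasDerivAt
    have h2 := (((h1.const_mul w⁻¹).add_const (w⁻¹ ^ 2)).neg).mul ((h1.const_mul w).neg.cexp)
    refine h2.congr_deriv ?_
    simp only [Pi.neg_apply]
    field_simp
    ring
  have hint : IntegrableOn (fun y : ℝ => (y : ℂ) * Complex.exp (-(w * y))) (Set.Ioi 0) := by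
    have h1 := Real.GammaIntegral_convergent (s := 2) two_pos
    refine Integrable.mono' h1 (by fun_prop) ?_
    filter_upwards [ae_restrict_mem measurableSet_Ioi] with y hy
    rw [norm_mul, hnorm, Complex.norm_real, Real.norm_of_nonneg (le_of_lt hy)]
    norm_num [mul_comm]
  have hlim : Tendsto (fun y : ℝ => -(w⁻¹ * y + w⁻¹ ^ 2) * Complex.exp (-(w * y))) atTop (𝓝 0) := by
    rw [tendsto_zero_iff_norm_tendsto_zero]
    have h1 : Tendsto (fun y : ℝ => ‖w⁻¹‖ * (y ^ 1 * Real.exp (-y)) +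
        ‖w⁻¹‖ ^ 2 * (y ^ 0 * Real.exp (-y))) atTop (𝓝 (‖w⁻¹‖ * 0 + ‖w⁻¹‖ ^ 2 * 0)) :=
      ((Real.tendsto_pow_mul_exp_neg_atTop_nhds_zero 1).const_mul _).add
        ((Real.tendsto_pow_mul_exp_neg_atTop_nhds_zero 0).const_mul _)
    rw [mul_zero, mul_zero, add_zero] at h1
    refine squeeze_zero' (Eventually.of_forall fun _ => norm_nonneg _) ?_ h1
    filter_upwards [eventually_ge_atTop 0] with y hy
    rw [norm_mul, hnorm, norm_neg]
    have : ‖w⁻¹ * (y : ℂ) + w⁻¹ ^ 2‖ ≤ ‖w⁻¹‖ * y + ‖w⁻¹‖ ^ 2 := by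
      refine (norm_add_le _ _).trans (le_of_eq ?_)
      rw [norm_mul, norm_pow, Complex.norm_real, Real.norm_of_nonneg hy]
    calc _ ≤ (‖w⁻¹‖ * y + ‖w⁻¹‖ ^ 2) * Real.exp (-y) :=
          mul_le_mul_of_nonneg_right this (Real.exp_pos _).le
      _ = _ := by ring
  have h := integral_Ioi_of_hasDerivAt_of_tendsto' hderiv hint hlim
  rw [h]
  simp

theorem integral_exp_gammaMeasure (c : ℝ) :
    ∫ g, Complex.exp (Complex.I * (c * g : ℝ)) ∂(gammaMeasure 2 1) =
      ((1 - Complex.I * c)⁻¹) ^ 2 := by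
  rw [gammaMeasure, integral_withDensity_eq_integral_toReal_smul
    (show Measurable (gammaPDF 2 1) from (measurable_gammaPDFReal 2 1).ennreal_ofReal) (ae_of_all _ fun _ => ENNReal.ofReal_lt_top),
    ← integral_Ioi_mul_exp_neg_mul (w := 1 - Complex.I * c) (by simp)]
  rw [← integral_indicator measurableSet_Ioi]
  refine integral_congr_ae (ae_of_all _ fun y => ?_)
  rcases lt_or_ge 0 y with hy | hy
  · rw [Set.indicator_of_mem (by exact hy)]
    simp only [gammaPDF_of_nonneg hy.le]
    have h2 : (2 : ℝ) - 1 = 1 := by norm_num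
    rw [h2, Real.Gamma_two, Real.one_rpow, Real.rpow_one, ENNReal.toReal_ofReal (by positivity),
      Complex.real_smul]
    push_cast
    rw [mul_assoc, ← Complex.exp_add]
    congr 2
    · ring
    · ring
  · rw [Set.indicator_of_notMem (by simpa using hy)]
    rcases hy.lt_or_eq with hy | rfl
    · simp [gammaPDF_of_neg hy]
    · norm_num [gammaPDF_of_nonneg]

theorem continuous_exp_I_mul_sum {d : ℕ} (θ : Fin d → ℝ) :
    Continuous fun y : Fin d → ℝ => Complex.exp (Complex.I * (∑ i, θ i * y i : ℝ)) :=
  Complex.continuous_exp.comp (continuous_const.mul (Complex.continuous_ofReal.comp (by fun_prop)))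

theorem integral_exp_gammaMultiple {d : ℕ} (a θ : Fin d → ℝ) :
    ∫ y, Complex.exp (Complex.I * (∑ i, θ i * y i : ℝ)) ∂(gammaMultiple a : Measure (Fin d → ℝ)) =
      ((1 - Complex.I * (∑ i, θ i * a i : ℝ))⁻¹) ^ 2 := by
  rw [← integral_exp_gammaMeasure, gammaMultiple, ProbabilityMeasure.coe_mk,
    integral_map (by fun_prop) (continuous_exp_I_mul_sum θ).aestronglyMeasurable]
  refine integral_congr_ae (ae_of_all _ fun g => ?_)
  simp only [Pi.smul_apply, smul_eq_mul, Finset.sum_mul]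
  congr 3
  exact Finset.sum_congr rfl fun i _ => by ring

end Gamma

/-- Lévy's convergence theorem on `Fin d → ℝ`. -/
theorem tendsto_of_tendsto_integral_exp {d : ℕ} {μ : ℕ → ProbabilityMeasure (Fin d → ℝ)}
    {ν : ProbabilityMeasure (Fin d → ℝ)}
    (h : ∀ θ : Fin d → ℝ, Tendsto
      (fun n => ∫ y, Complex.exp (Complex.I * (∑ i, θ i * y i : ℝ)) ∂(μ n : Measure (Fin d → ℝ)))
      atTop (𝓝 (∫ y, Complex.exp (Complex.I * (∑ i, θ i * y i : ℝ)) ∂(ν : Measure (Fin d → ℝ))))) :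
    Tendsto μ atTop (𝓝 ν) := by
  -- Characteristic functions use an inner product, so the laws are transported to Euclidean space
  -- and back along the identity homeomorphism.
  have hto : Continuous (WithLp.toLp 2 : (Fin d → ℝ) → EuclideanSpace ℝ (Fin d)) :=
    PiLp.continuous_toLp 2 _
  have hof : Continuous (WithLp.ofLp : EuclideanSpace ℝ (Fin d) → (Fin d → ℝ)) :=
    PiLp.continuous_ofLp 2 _
  have hchar : ∀ (m : ProbabilityMeasure (Fin d → ℝ)) (t : EuclideanSpace ℝ (Fin d)),
      charFun ((m.map hto.measurable.aemeasurable : ProbabilityMeasure (EuclideanSpace ℝ (Fin d))) :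
        Measure (EuclideanSpace ℝ (Fin d))) t =
        ∫ y, Complex.exp (Complex.I * (∑ i, t i * y i : ℝ)) ∂(m : Measure (Fin d → ℝ)) := by
    intro m t
    rw [charFun_apply, ProbabilityMeasure.toMeasure_map,
      integral_map hto.measurable.aemeasurable (by fun_prop)]
    refine integral_congr_ae (ae_of_all _ fun y => ?_)
    simp only [PiLp.inner_apply]
    rw [mul_comm]
    rfl
  have h1 : Tendsto (fun n => (μ n).map hto.measurable.aemeasurable) atTop
      (𝓝 (ν.map hto.measurable.aemeasurable)) := by
    refine ProbabilityMeasure.tendsto_of_tendsto_charFun fun t => ?_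
    simp_rw [hchar]
    exact h fun i => t i
  have h2 := ProbabilityMeasure.tendsto_map_of_tendsto_of_continuous _ _ h1 hof
  have hid : ∀ m : ProbabilityMeasure (Fin d → ℝ),
      (m.map hto.measurable.aemeasurable).map hof.measurable.aemeasurable = m := by
    intro m
    refine Subtype.ext ?_
    change ((m : Measure (Fin d → ℝ)).map _).map _ = (m : Measure (Fin d → ℝ))
    rw [Measure.map_map hof.measurable hto.measurable]
    exact Measure.map_id
  simpa only [hid] using h2

/-! ### All frequencies simultaneously. -/

/-- The additive functional `v ↦ ∑ i, θ i * v i` on `ℤ^d`. -/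
noncomputable def linearFunctional {d : ℕ} (θ : Fin d → ℝ) : (Fin d → ℤ) →+ ℝ where
  toFun v := ∑ i, θ i * v i
  map_zero' := by simp
  map_add' u v := by simp [mul_add, Finset.sum_add_distrib]

theorem linearFunctional_apply {d : ℕ} (θ : Fin d → ℝ) (v : Fin d → ℤ) :
    linearFunctional θ v = ∑ i, θ i * v i := rfl

theorem linearFunctional_single {d : ℕ} (i : Fin d) (v : Fin d → ℤ) :
    linearFunctional (Pi.single i 1) v = v i := by
  rw [linearFunctional_apply, Finset.sum_eq_single i] <;> simp +contextual

theorem labelSum_linearFunctional {Ω : Type*} {d : ℕ} (X : ℕ → Ω → Fin d → ℤ) (θ : Fin d → ℝ)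
    (n : ℕ) (ω : Ω) : labelSum X (linearFunctional θ) n ω =
      ∑ i, θ i * labelSum X (linearFunctional (Pi.single i 1)) n ω := by
  simp only [labelSum, linearFunctional_single, Finset.mul_sum]
  rw [Finset.sum_comm]
  rfl

/-- The characteristic function of the empirical distribution, rescaled by `n + 1`. -/
noncomputable def scaledCharFun {Ω : Type*} {d : ℕ} (X : ℕ → Ω → Fin d → ℤ) (ω : Ω) (n : ℕ)
    (θ : Fin d → ℝ) : ℂ :=
  (n : ℂ)⁻¹ * ∑ k ∈ Finset.Icc 1 n,
    Complex.exp (Complex.I * (linearFunctional θ (X k ω) / (n + 1 : ℕ) : ℝ))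

theorem integral_twoDrawSum_empirical {Ω : Type*} {d : ℕ} (X : ℕ → Ω → Fin d → ℤ) (ω : Ω) {n : ℕ}
    (hn : 1 ≤ n) (θ : Fin d → ℝ) :
    ∫ y, Complex.exp (Complex.I * (∑ i, θ i * y i : ℝ))
        ∂((twoDrawSum (empirical X n ω)).map fun v => ((n : ℝ) + 1)⁻¹ • toRealVec v) =
      scaledCharFun X ω n θ ^ 2 := by
  have := isProbabilityMeasure_empirical X hn ω
  set F : (Fin d → ℤ) → ℂ := fun v =>
    Complex.exp (Complex.I * (linearFunctional θ v / (n + 1 : ℕ) : ℝ)) with hF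
  have h1 : ∀ v : Fin d → ℤ, Complex.exp (Complex.I *
      (∑ i, θ i * (((n : ℝ) + 1)⁻¹ • toRealVec v) i : ℝ)) = F v := by
    intro v
    simp only [hF, linearFunctional_apply, Finset.sum_div, toRealVec, Pi.smul_apply, smul_eq_mul]
    congr 3
    refine Finset.sum_congr rfl fun i _ => ?_
    push_cast
    ring
  have h2 : ∀ u v, F (u + v) = F u * F v := by
    intro u v
    simp only [hF]
    rw [← Complex.exp_add, map_add]
    congr 1
    push_cast
    ring
  have h3 : ∫ v, F v ∂(empirical X n ω) = scaledCharFun X ω n θ := by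
    rw [empirical, integral_smul_measure, integral_finsetSum_measure]
    · simp [scaledCharFun, hF]
    · intro k _
      exact integrable_dirac (by simp)
  have hm : Measurable fun v : Fin d → ℤ => ((n : ℝ) + 1)⁻¹ • toRealVec v := measurable_of_countable _
  rw [integral_map hm.aemeasurable (continuous_exp_I_mul_sum θ).aestronglyMeasurable]
  simp_rw [h1]
  rw [twoDrawSum, integral_map (by fun_prop) (measurable_of_countable F).aestronglyMeasurable]
  simp_rw [h2]
  rw [integral_prod_mul, h3, pow_two]

/-- Since `y ↦ e^{iy}` is 1-Lipschitz, the variation in `θ i` is controlled by the sum of the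
absolute `i`-th coordinates over `n²`, with a constant independent of `n`. -/
theorem norm_scaledCharFun_sub_le {Ω : Type*} {d : ℕ} (X : ℕ → Ω → Fin d → ℤ) (ω : Ω) {n : ℕ}
    (hn : 1 ≤ n) (θ θ' : Fin d → ℝ) {B : Fin d → ℝ}
    (hB : ∀ i, labelSum X (fun v => |linearFunctional (Pi.single i 1) v|) n ω ≤ B i * (n : ℝ) ^ 2) :
    ‖scaledCharFun X ω n θ - scaledCharFun X ω n θ'‖ ≤ ∑ i, |θ i - θ' i| * B i := by
  have hn0 : (0 : ℝ) < n := by exact_mod_cast hn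
  have hterm : ∀ v : Fin d → ℤ,
      ‖Complex.exp (Complex.I * (linearFunctional θ v / (n + 1 : ℕ) : ℝ)) -
        Complex.exp (Complex.I * (linearFunctional θ' v / (n + 1 : ℕ) : ℝ))‖ ≤
      (n : ℝ)⁻¹ * ∑ i, |θ i - θ' i| * |linearFunctional (Pi.single i 1) v| := by
    intro v
    set a : ℝ := linearFunctional θ v / (n + 1 : ℕ)
    set b : ℝ := linearFunctional θ' v / (n + 1 : ℕ)
    have e : Complex.exp (Complex.I * a) - Complex.exp (Complex.I * b) =
        Complex.exp (Complex.I * b) * (Complex.exp (Complex.I * (a - b : ℝ)) - 1) := by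
      rw [mul_sub, ← Complex.exp_add, mul_one]
      congr 2
      push_cast
      ring
    rw [e, norm_mul, Complex.norm_exp_I_mul_ofReal, one_mul]
    refine (Real.norm_exp_I_mul_ofReal_sub_one_le).trans ?_
    have e2 : a - b = ((n : ℝ) + 1)⁻¹ * ∑ i, (θ i - θ' i) * v i := by
      simp only [a, b, linearFunctional_apply, sub_mul, Finset.sum_sub_distrib]
      push_cast
      ring
    rw [e2, norm_mul, Real.norm_of_nonneg (by positivity)]
    refine mul_le_mul (inv_anti₀ hn0 (by linarith)) ?_ (norm_nonneg _) (by positivity)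
    refine norm_sum_le_of_le _ fun i _ => ?_
    rw [linearFunctional_single, norm_mul, Real.norm_eq_abs, Real.norm_eq_abs]
  rw [scaledCharFun, scaledCharFun, ← mul_sub, ← Finset.sum_sub_distrib, norm_mul, norm_inv,
    Complex.norm_natCast]
  calc (n : ℝ)⁻¹ * ‖∑ k ∈ Finset.Icc 1 n,
        (Complex.exp (Complex.I * (linearFunctional θ (X k ω) / (n + 1 : ℕ) : ℝ)) -
        Complex.exp (Complex.I * (linearFunctional θ' (X k ω) / (n + 1 : ℕ) : ℝ)))‖
      ≤ (n : ℝ)⁻¹ * ∑ k ∈ Finset.Icc 1 n, (n : ℝ)⁻¹ *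
          ∑ i, |θ i - θ' i| * |linearFunctional (Pi.single i 1) (X k ω)| := by
        gcongr
        exact norm_sum_le_of_le _ fun k _ => hterm _
    _ = ((n : ℝ) ^ 2)⁻¹ * ∑ i, |θ i - θ' i| *
          labelSum X (fun v => |linearFunctional (Pi.single i 1) v|) n ω := by
        rw [← Finset.mul_sum, Finset.sum_comm, ← mul_assoc, pow_two, mul_inv]
        simp only [labelSum, Finset.mul_sum]
    _ ≤ ((n : ℝ) ^ 2)⁻¹ * ∑ i, |θ i - θ' i| * (B i * (n : ℝ) ^ 2) := by
        gcongr with i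
        exact hB i
    _ = ∑ i, |θ i - θ' i| * B i := by
        simp only [← mul_assoc, ← Finset.sum_mul]
        field_simp

theorem denseRange_ratCast_pi (d : ℕ) :
    DenseRange fun (q : Fin d → ℚ) (i : Fin d) => (q i : ℝ) :=
  DenseRange.piMap (f := fun _ => ((↑) : ℚ → ℝ)) fun _ => Rat.denseRange_cast

theorem equicontinuousAt_scaledCharFun {Ω : Type*} {d : ℕ} (X : ℕ → Ω → Fin d → ℤ) (ω : Ω)
    {τ₀ : ℕ} (hτ₀ : 1 ≤ τ₀) {B : Fin d → ℝ}
    (hB : ∀ i n, τ₀ ≤ n →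
      labelSum X (fun v => |linearFunctional (Pi.single i 1) v|) n ω ≤ B i * (n : ℝ) ^ 2)
    (θ : Fin d → ℝ) : EquicontinuousAt (fun n θ => scaledCharFun X ω (n + τ₀) θ) θ := by
  refine Metric.equicontinuousAt_of_continuity_modulus (fun θ' => ∑ i, |θ i - θ' i| * B i) ?_ _
    (Eventually.of_forall fun θ' n => ?_)
  · have hc : Continuous fun θ' : Fin d → ℝ => ∑ i, |θ i - θ' i| * B i := by fun_prop
    have := hc.tendsto θ
    simpa using this
  · rw [dist_eq_norm]
    exact norm_scaledCharFun_sub_le X ω (by omega) θ θ' fun i => hB i _ (by omega)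

theorem continuous_inv_one_sub_I_mul_sum {d : ℕ} (a : Fin d → ℝ) :
    Continuous fun θ : Fin d → ℝ => (1 - Complex.I * (∑ i, θ i * a i : ℝ))⁻¹ := by
  refine Continuous.inv₀ ?_ fun θ => one_sub_I_mul_ne_zero _
  exact continuous_const.sub (continuous_const.mul (Complex.continuous_ofReal.comp (by fun_prop)))

theorem tendsto_of_rat_of_equicontinuousAt {d : ℕ} {F : ℕ → (Fin d → ℝ) → ℂ} {g : (Fin d → ℝ) → ℂ}
    {θ : Fin d → ℝ} (hF : EquicontinuousAt F θ) (hg : ContinuousAt g θ)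
    (h : ∀ q : Fin d → ℚ, Tendsto (fun n => F n fun i => (q i : ℝ)) atTop
      (𝓝 (g fun i => (q i : ℝ)))) :
    Tendsto (fun n => F n θ) atTop (𝓝 (g θ)) := by
  refine hF.tendsto_of_mem_closure (hg.tendsto.mono_left nhdsWithin_le_nhds) ?_
    (denseRange_ratCast_pi d θ)
  rintro _ ⟨q, rfl⟩
  exact h q

theorem tendsto_scaledCharFun_of_rat {Ω : Type*} {d : ℕ} (X : ℕ → Ω → Fin d → ℤ) (ω : Ω)
    {τ₀ : ℕ} (hτ₀ : 1 ≤ τ₀) {B a : Fin d → ℝ}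
    (hB : ∀ i n, τ₀ ≤ n →
      labelSum X (fun v => |linearFunctional (Pi.single i 1) v|) n ω ≤ B i * (n : ℝ) ^ 2)
    (h : ∀ q : Fin d → ℚ, Tendsto (fun n => scaledCharFun X ω n fun i => (q i : ℝ)) atTop
      (𝓝 (1 - Complex.I * (∑ i, (q i : ℝ) * a i : ℝ))⁻¹)) (θ : Fin d → ℝ) :
    Tendsto (fun n => scaledCharFun X ω n θ) atTop
      (𝓝 (1 - Complex.I * (∑ i, θ i * a i : ℝ))⁻¹) :=
  (tendsto_add_atTop_iff_nat τ₀).1 <| tendsto_of_rat_of_equicontinuousAt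
    (g := fun θ => (1 - Complex.I * (∑ i, θ i * a i : ℝ))⁻¹)
    (equicontinuousAt_scaledCharFun X ω hτ₀ hB θ)
    (continuous_inv_one_sub_I_mul_sum a).continuousAt
    fun q => (tendsto_add_atTop_iff_nat τ₀).2 (h q)

namespace IsAdditionUrn

variable {Ω : Type*} [MeasurableSpace Ω] {P : Measure Ω} [IsProbabilityMeasure P]
    {d τ₀ : ℕ} {x : Fin τ₀ → Fin d → ℤ} {X : ℕ → Ω → Fin d → ℤ}

/-- Convergence for a single functional has its own null set. Countably many rational `θ` share one,
and the pathwise bounds on absolute sums give the equicontinuity that reaches every real `θ`. -/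
theorem ae_forall_tendsto_scaledCharFun (hX : IsAdditionUrn P x X) (hτ₀ : 1 ≤ τ₀)
    {A : Ω → Fin d → ℝ} (hA : ∀ᵐ ω ∂P, ∀ i, Tendsto (fun n : ℕ => ((n : ℝ) * (n + 1))⁻¹ *
      labelSum X (linearFunctional (Pi.single i 1)) n ω) atTop (𝓝 (A ω i))) :
    ∀ᵐ ω ∂P, ∀ θ : Fin d → ℝ, Tendsto (fun n => scaledCharFun X ω n θ) atTop
      (𝓝 (1 - Complex.I * (∑ i, θ i * A ω i : ℝ))⁻¹) := by
  have hq : ∀ᵐ ω ∂P, ∀ q : Fin d → ℚ, Tendsto (fun n => scaledCharFun X ω n fun i => (q i : ℝ)) atTop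
      (𝓝 (1 - Complex.I * (∑ i, (q i : ℝ) * A ω i : ℝ))⁻¹) := by
    refine ae_all_iff.2 fun q => ?_
    refine hX.ae_tendsto_sum_exp hτ₀ (linearFunctional fun i => (q i : ℝ)) ?_
    filter_upwards [hA] with ω hω
    refine (tendsto_finsetSum Finset.univ fun i _ => (hω i).const_mul (q i : ℝ)).congr fun n => ?_
    rw [labelSum_linearFunctional, Finset.mul_sum]
    exact Finset.sum_congr rfl fun i _ => by ring
  have hB := ae_all_iff.2 fun i : Fin d =>
    hX.exists_forall_labelSum_abs_le hτ₀ (linearFunctional (Pi.single i 1))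
  filter_upwards [hq, hB] with ω h1 h2 θ
  choose B hB using h2
  exact tendsto_scaledCharFun_of_rat X ω hτ₀ hB h1 θ

end IsAdditionUrn

theorem theorem2 {Ω : Type*} [MeasurableSpace Ω] (P : Measure Ω) [IsProbabilityMeasure P]
    {d τ₀ : ℕ} (hτ₀ : 1 ≤ τ₀) (x : Fin τ₀ → Fin d → ℤ) (X : ℕ → Ω → Fin d → ℤ)
    (hX : IsAdditionUrn P x X) :
    (∀ n, Integrable (fun ω => toRealVec (X (n + 1) ω)) P) ∧
    ∃ A : Ω → Fin d → ℝ, Measurable A ∧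
      (∀ᵐ ω ∂P, Tendsto
        (fun n : ℕ => (2 * ((n : ℝ) + 1))⁻¹ •
          (P[fun ω' => toRealVec (X (n + 1) ω') | sigmaEmpirical X n]) ω)
        atTop (𝓝 (A ω))) ∧
      (∀ i : Fin d, (∃ k, x k i ≠ 0) → 0 < P {ω | A ω i ≠ 0}) ∧
      (∀ᵐ ω ∂P, Tendsto (fun n => condLaw P X n ω) atTop (𝓝 (gammaMultiple (A ω)))) := by
  refine ⟨fun n => hX.integrable_toRealVec hτ₀ (by omega), ?_⟩
  choose A hAm hAlim hApos using fun i : Fin d =>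
    hX.exists_tendsto_labelSum hτ₀ (linearFunctional (Pi.single i 1))
  have hlim := ae_all_iff.2 hAlim
  refine ⟨fun ω i => A i ω, measurable_pi_lambda _ hAm, ?_, ?_, ?_⟩
  · have hcond : ∀ᵐ ω ∂P, ∀ n, τ₀ ≤ n → ∀ i,
        P[fun ω' => toRealVec (X (n + 1) ω') | sigmaEmpirical X n] ω i =
          drawMean X (fun v => (v i : ℝ)) n ω := by
      refine ae_all_iff.2 fun n => ?_
      by_cases hn : τ₀ ≤ n
      · filter_upwards [hX.condExp_toRealVec hτ₀ hn] with ω hω _ using hω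
      · exact ae_of_all _ fun ω h => (hn h).elim
    filter_upwards [hcond, hlim] with ω h1 h2
    refine tendsto_pi_nhds.2 fun i => (h2 i).congr' ?_
    filter_upwards [eventually_ge_atTop τ₀] with n hn
    -- The conditional mean is `2 S_n / n`, so division by `2 (n + 1)` gives exactly the martingale
    -- normalization.
    have h3 := drawMean_addMonoidHom X (hτ₀.trans hn) (linearFunctional (Pi.single i 1)) ω
    have h4 : drawMean X (fun v => (v i : ℝ)) n ω =
        drawMean X (linearFunctional (Pi.single i 1)) n ω :=
      drawMean_congr X fun j _ k _ => (linearFunctional_single i _).symm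
    rw [Pi.smul_apply, h1 n hn i, h4, h3, smul_eq_mul]
    have hn0 : (n : ℝ) ≠ 0 := by
      have := hτ₀.trans hn
      positivity
    field_simp
  · rintro i ⟨k, hk⟩
    refine hApos i ⟨k, ?_⟩
    rw [linearFunctional_single]
    exact_mod_cast hk
  · have hlaw : ∀ᵐ ω ∂P, ∀ n, τ₀ ≤ n → (condLaw P X n ω : Measure (Fin d → ℝ)) =
        (twoDrawSum (empirical X n ω)).map fun v => ((n : ℝ) + 1)⁻¹ • toRealVec v := by
      refine ae_all_iff.2 fun n => ?_
      by_cases hn : τ₀ ≤ n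
      · filter_upwards [hX.condLaw_eq hτ₀ hn] with ω hω _ using hω
      · exact ae_of_all _ fun ω h => (hn h).elim
    filter_upwards [hlaw, hX.ae_forall_tendsto_scaledCharFun hτ₀ (A := fun ω i => A i ω) hlim]
      with ω h1 h2
    refine tendsto_of_tendsto_integral_exp fun θ => ?_
    rw [integral_exp_gammaMultiple]
    -- The square comes from the two independent draws and produces the shape `2`.
    refine ((h2 θ).pow 2).congr' ?_
    filter_upwards [eventually_ge_atTop τ₀] with n hn
    rw [h1 n hn, integral_twoDrawSum_empirical X ω (hτ₀.trans hn)]
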